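/- Let $n\ge 2$ and let $(M^n,\mathbf p)$ be a projective manifold: $M$ is a smooth $n$-manifold and $\mathbf p$ is an equivalence class of smooth torsion-free affine connections (the Weyl connections), where $\nabla\sim\widehat\nabla$ means $\widehat\nabla_aY^b=\nabla_aY^b+\Upsilon_aY^b+\Upsilon_cY^c\delta_a^b$ for some smooth $1$-form $\Upsilon$. For $\nabla\in\mathbf p$ let $R_{ab}{}^c{}_d$ be its curvature, $(\nabla_a\nabla_b-\nabla_b\nabla_a)v^c=R_{ab}{}^c{}_dv^d$, let $\mathrm{Ric}_{ab}=R_{ca}{}^c{}_b$, and let the projective Schouten tensor $\mathsf P_{ab}$ be given by $(n-1)\mathsf P_{ab}=\mathrm{Ric}_{ab}+\beta_{ab}$, $\beta_{ab}=-2\mathsf P_{[ab]}$. A scale connection is a $\nabla\in\mathbf p$ with symmetric Schouten tensor. For $k\ge1$ and a scale connection $\nabla$ put $$(p_k)_{a_1\cdots a_{2k}}:=R_{a_1a_2}{}^{c_1}{}_{c_2}R_{a_3a_4}{}^{c_2}{}_{c_3}\cdots R_{a_{2k-1}a_{2k}}{}^{c_k}{}_{c_1},$$ skewed over $a_1,\dots,a_{2k}$.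 Let $\mathcal E(1)$ be the positive $(2n+2)$-th root of $(\Lambda^nTM)^2$, $\mathcal E(w)=\mathcal E(1)^w$, and let the tractor bundle $\mathcal T$ be the dual of the bundle $J^1\mathcal E(1)$ of $1$-jets of sections of $\mathcal E(1)$. Each $\nabla\in\mathbf p$ induces a connection on $\mathcal E(1)$, hence a splitting $\mathcal T\cong TM(-1)\oplus\mathcal E(-1)$, in which one defines the tractor connection by $$\nabla^{\mathcal T}_a(\nu^b,\rho)=(\nabla_a\nu^b+\rho\,\delta_a^b,\ \nabla_a\rho-\mathsf P_{ab}\nu^b).$$ Let $\Omega_{ab}{}^C{}_D$ be the curvature of $\nabla^{\mathcal T}$ and, for $k\ge 1$, put $$(q_k)_{a_1\cdots a_{2k}}:=\Omega_{a_1a_2}{}^{C_1}{}_{C_2}\Omega_{a_3a_4}{}^{C_2}{}_{C_3}\cdots\Omega_{a_{2k-1}a_{2k}}{}^{C_k}{}_{C_1},$$ skewed over $a_1,\dots,a_{2k}$. Then the connection $\nabla^{\mathcal T}$ on $\mathcal T$ does not depend on the choice of $\nabla\in\mathbf p$ used to define it, and for every $k\ge1$ and every scale connection in $\mathbf p$,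 $$q_k=p_k .$$ So the $p_k$ are characteristic-type forms of a projectively invariant connection. -/

import Mathlib

open scoped Manifold ContDiff Bundle

noncomputable section

namespace ProjectiveTractor

variable {n : ℕ} {M : Type*} [TopologicalSpace M]
  [ChartedSpace (EuclideanSpace ℝ (Fin n)) M] [IsManifold (𝓡 n) ∞ M]

/-! ### Curvature and characteristic forms of a connection on a vector bundle -/

section Curvature

variable (F : Type*) [NormedAddCommGroup F] [NormedSpace ℝ F]
  {V : M → Type*} [TopologicalSpace (Bundle.TotalSpace F V)]
  [∀ x, AddCommGroup (V x)] [∀ x, Module ℝ (V x)] [∀ x, TopologicalSpace (V x)]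
  [FiberBundle F V]

/-- The curvature `(∇_X ∇_Y - ∇_Y ∇_X - ∇_[X,Y]) s` at `x` of a connection `D` on a vector bundle
`V`, where `D s y a` is the covariant derivative of the section `s` at `y` in the direction `a`.
Here `X`, `Y`, `s` extend `u`, `v`, `w`, with constant coefficients in the preferred
trivializations at `x`; for a smooth connection the result is independent of the extensions. -/
def curvature (D : (Π y, V y) → Π y : M, TangentSpace (𝓡 n) y → V y) (x : M)
    (u v : TangentSpace (𝓡 n) x) (w : V x) : V x :=
  let X : Π y : M, TangentSpace (𝓡 n) y := FiberBundle.extend (EuclideanSpace ℝ (Fin n)) u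
  let Y : Π y : M, TangentSpace (𝓡 n) y := FiberBundle.extend (EuclideanSpace ℝ (Fin n)) v
  let s : Π y, V y := FiberBundle.extend F w
  D (fun y => D s y (Y y)) x u - D (fun y => D s y (X y)) x v
    - D s x (VectorField.mlieBracket (𝓡 n) X Y x)

variable [VectorBundle ℝ F V]

/-- A basis of the fibre `V x`. -/
def fibreBasis [FiniteDimensional ℝ F] (x : M) :
    Module.Basis (Fin (Module.finrank ℝ F)) ℝ (V x) :=
  (Module.finBasis ℝ F).map
    (VectorBundle.continuousLinearEquivAt ℝ F V x).symm.toLinearEquiv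

/-- The curvature in the directions `u`, `v` as an endomorphism of the fibre `V x`: the linear map
with the values `curvature F D x u v w` for `w` in a basis. -/
def curvatureEnd [FiniteDimensional ℝ F]
    (D : (Π y, V y) → Π y : M, TangentSpace (𝓡 n) y → V y) (x : M)
    (u v : TangentSpace (𝓡 n) x) : Module.End ℝ (V x) :=
  (fibreBasis F x).constr ℝ fun i => curvature F D x u v (fibreBasis F x i)

/-- The `2k`-form obtained by skewing
`Ω_{a₁a₂}^{C₁}_{C₂} Ω_{a₃a₄}^{C₂}_{C₃} ⋯ Ω_{a_{2k-1}a_{2k}}^{C_k}_{C₁}` over `a₁, …, a_{2k}`,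
where `Ω` is the curvature of the connection `D` on `V`, evaluated on the tangent vectors `v`. -/
def curvatureForm [FiniteDimensional ℝ F]
    (D : (Π y, V y) → Π y : M, TangentSpace (𝓡 n) y → V y) (k : ℕ) (x : M)
    (v : Fin (2 * k) → TangentSpace (𝓡 n) x) : ℝ :=
  ((2 * k).factorial : ℝ)⁻¹ * ∑ τ : Equiv.Perm (Fin (2 * k)),
    ((Equiv.Perm.sign τ : ℤ) : ℝ) * LinearMap.trace ℝ (V x)
      (List.ofFn fun i : Fin k =>
        curvatureEnd F D x (v (τ ⟨2 * i, by omega⟩)) (v (τ ⟨2 * i + 1, by omega⟩))).prod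

end Curvature

/-! ### Affine connections and projective structures -/

section Affine

variable (n M) in
/-- Affine connections, i.e. connections on the tangent bundle of the `n`-manifold `M`. -/
abbrev AffineConnection :=
  CovariantDerivative (𝓡 n) (EuclideanSpace ℝ (Fin n)) (TangentSpace (𝓡 n) : M → Type _)

/-- Smooth torsion-free affine connections. -/
structure IsSmoothTorsionFree (nabla : AffineConnection n M) : Prop where
  smooth : nabla.ContMDiffCovariantDerivative ∞
  torsion : nabla.torsion = 0

/-- Projective equivalence: `∇'_a Y^b = ∇_a Y^b + Υ_a Y^b + Υ_c Y^c δ_a^b` for some smooth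
`1`-form `Υ`. -/
def ProjectivelyEquivalent (nabla nabla' : AffineConnection n M) : Prop :=
  ∃ Υ : Π x : M, TangentSpace (𝓡 n) x →L[ℝ] Bundle.Trivial M ℝ x,
    ContMDiff (𝓡 n) ((𝓡 n).prod 𝓘(ℝ, EuclideanSpace ℝ (Fin n) →L[ℝ] ℝ)) ∞
      (fun x => Bundle.TotalSpace.mk' (EuclideanSpace ℝ (Fin n) →L[ℝ] ℝ)
        (E := fun y : M => TangentSpace (𝓡 n) y →L[ℝ] Bundle.Trivial M ℝ y) x (Υ x)) ∧
    ∀ (Y : Π x : M, TangentSpace (𝓡 n) x) (x : M),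
      MDifferentiableAt (𝓡 n) (𝓡 n).tangent
        (fun y => (⟨y, Y y⟩ : TangentBundle (𝓡 n) M)) x → ∀ X : TangentSpace (𝓡 n) x,
        nabla' Y x X = nabla Y x X + (Υ x X : ℝ) • Y x + (Υ x (Y x) : ℝ) • X

variable (n M) in
/-- A projective structure on `M`: an equivalence class of smooth torsion-free affine connections
with respect to projective equivalence. Its members are the Weyl connections. -/
structure ProjectiveStructure where
  carrier : Set (AffineConnection n M)
  nonempty : carrier.Nonempty
  isSmoothTorsionFree : ∀ nabla ∈ carrier, IsSmoothTorsionFree nabla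
  mem_iff : ∀ nabla ∈ carrier, ∀ nabla' : AffineConnection n M,
    nabla' ∈ carrier ↔ IsSmoothTorsionFree nabla' ∧ ProjectivelyEquivalent nabla nabla'

/-- The vector `e_i` of the coordinate frame at `x` of the preferred chart at `x`. -/
def coordVec (x : M) (i : Fin n) : TangentSpace (𝓡 n) x :=
  (EuclideanSpace.single i 1 : EuclideanSpace ℝ (Fin n))

/-- The `i`-th component of a tangent vector at `x` in the coordinate frame `coordVec x`. -/
def comp (x : M) (i : Fin n) (u : TangentSpace (𝓡 n) x) : ℝ :=
  (show EuclideanSpace ℝ (Fin n) from u) i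

/-- The covariant derivative of vector fields, in the form `D s y a = ∇_a s (y)`. -/
def AffineConnection.deriv (nabla : AffineConnection n M)
    (Y : Π y : M, TangentSpace (𝓡 n) y) (x : M) (X : TangentSpace (𝓡 n) x) :
    TangentSpace (𝓡 n) x := nabla Y x X

/-- The Ricci tensor `Ric_{ab} = R_{ca}^c_b`. -/
def ricci (nabla : AffineConnection n M) (x : M) (u v : TangentSpace (𝓡 n) x) : ℝ :=
  ∑ i, comp x i (curvature (EuclideanSpace ℝ (Fin n)) nabla.deriv x (coordVec x i) u v)

/-- The projective Schouten tensor `P`, the solution of `(n - 1) P_{ab} = Ric_{ab} + β_{ab}` with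
`β_{ab} = - 2 P_{[ab]}` (see `schouten_spec`). -/
def schouten (nabla : AffineConnection n M) (x : M) (u v : TangentSpace (𝓡 n) x) : ℝ :=
  (n * ricci nabla x u v + ricci nabla x v u) / ((n : ℝ) ^ 2 - 1)

theorem schouten_spec (hn : 2 ≤ n) (nabla : AffineConnection n M) (x : M)
    (u v : TangentSpace (𝓡 n) x) :
    ((n : ℝ) - 1) * schouten nabla x u v =
      ricci nabla x u v - (schouten nabla x u v - schouten nabla x v u) := by
  have h : (2 : ℝ) ≤ n := by exact_mod_cast hn
  have h1 : ((n : ℝ) ^ 2 - 1) ≠ 0 := by nlinarith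
  unfold schouten
  field_simp
  ring

/-- Scale connections, as affine connections with symmetric Schouten tensor. -/
def IsScaleConnection (nabla : AffineConnection n M) : Prop :=
  ∀ (x : M) (u v : TangentSpace (𝓡 n) x), schouten nabla x u v = schouten nabla x v u

end Affine

/-! ### Projective densities and weighted vector fields -/

section Density

/-- The change of coordinates of tangent vectors at `x` from the chart `i` to the chart `j`. -/
def tangentChange (i j : atlas (EuclideanSpace ℝ (Fin n)) M) (x : M) :
    EuclideanSpace ℝ (Fin n) →L[ℝ] EuclideanSpace ℝ (Fin n) :=
  (tangentBundleCore (𝓡 n) M).coordChange i j x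

lemma tangentChange_self (i : atlas (EuclideanSpace ℝ (Fin n)) M) {x : M} (hx : x ∈ i.1.source) :
    tangentChange i i x = ContinuousLinearMap.id ℝ _ := by
  ext1 v; exact (tangentBundleCore (𝓡 n) M).coordChange_self i x hx v

lemma tangentChange_comp (i j k : atlas (EuclideanSpace ℝ (Fin n)) M) {x : M}
    (hx : x ∈ i.1.source ∩ j.1.source ∩ k.1.source) :
    (tangentChange j k x).comp (tangentChange i j x) = tangentChange i k x :=
  (tangentBundleCore (𝓡 n) M).coordChange_linear_comp i j k x hx

lemma det_comp' (A B : EuclideanSpace ℝ (Fin n) →L[ℝ] EuclideanSpace ℝ (Fin n)) :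
    (A.comp B).det = A.det * B.det := LinearMap.det_comp _ _

lemma det_tangentChange_ne_zero (i j : atlas (EuclideanSpace ℝ (Fin n)) M) {x : M}
    (hx : x ∈ i.1.source ∩ j.1.source) : (tangentChange i j x).det ≠ 0 := by
  have h := tangentChange_comp i j i (x := x) ⟨hx, hx.1⟩
  rw [tangentChange_self i hx.1] at h
  have h2 := congrArg ContinuousLinearMap.det h
  rw [det_comp'] at h2
  have h3 : (ContinuousLinearMap.id ℝ (EuclideanSpace ℝ (Fin n))).det = 1 := LinearMap.det_id
  rw [h3] at h2
  exact right_ne_zero_of_mul (h2 ▸ one_ne_zero)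

/-- The transition function of `E(w)`. As `E(1)` is the positive `(2n+2)`-th root of `(Λⁿ TM)²`,
and the transition function of `Λⁿ TM` is `det A` for `A = tangentChange i j x`, the transition
function of `E(w)` is `((det A)²)^(w/(2n+2)) = |det A|^(w/(n+1))`. -/
def densityFactor (w : ℝ) (i j : atlas (EuclideanSpace ℝ (Fin n)) M) (x : M) : ℝ :=
  |(tangentChange i j x).det| ^ (w / (n + 1))

lemma densityFactor_self (w : ℝ) (i : atlas (EuclideanSpace ℝ (Fin n)) M) {x : M}
    (hx : x ∈ i.1.source) : densityFactor w i i x = 1 := by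
  have h3 : (ContinuousLinearMap.id ℝ (EuclideanSpace ℝ (Fin n))).det = 1 := LinearMap.det_id
  simp [densityFactor, tangentChange_self i hx, h3]

lemma densityFactor_comp (w : ℝ) (i j k : atlas (EuclideanSpace ℝ (Fin n)) M) {x : M}
    (hx : x ∈ i.1.source ∩ j.1.source ∩ k.1.source) :
    densityFactor w j k x * densityFactor w i j x = densityFactor w i k x := by
  simp only [densityFactor]
  rw [← tangentChange_comp i j k hx, det_comp', abs_mul,
    Real.mul_rpow (abs_nonneg _) (abs_nonneg _)]

lemma continuousOn_det_tangentChange (i j : atlas (EuclideanSpace ℝ (Fin n)) M) :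
    ContinuousOn (fun x => (tangentChange i j x).det) (i.1.source ∩ j.1.source) :=
  ContinuousLinearMap.continuous_det.comp_continuousOn
    ((tangentBundleCore (𝓡 n) M).continuousOn_coordChange i j)

lemma continuousOn_densityFactor (w : ℝ) (i j : atlas (EuclideanSpace ℝ (Fin n)) M) :
    ContinuousOn (densityFactor w i j) (i.1.source ∩ j.1.source) :=
  (continuousOn_det_tangentChange i j).abs.rpow_const
    fun _ hx => Or.inl (abs_ne_zero.2 (det_tangentChange_ne_zero i j hx))

variable (n M) in
/-- The line bundle `E(w)` of projective densities of weight `w`. -/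
def densityCore (w : ℝ) :
    VectorBundleCore ℝ M ℝ (atlas (EuclideanSpace ℝ (Fin n)) M) where
  baseSet i := i.1.source
  isOpen_baseSet i := i.1.open_source
  indexAt := achart (EuclideanSpace ℝ (Fin n))
  mem_baseSet_at := mem_chart_source (EuclideanSpace ℝ (Fin n))
  coordChange i j x := densityFactor w i j x • ContinuousLinearMap.id ℝ ℝ
  coordChange_self i x hx v := by simp [densityFactor_self w i hx]
  continuousOn_coordChange i j := (continuousOn_densityFactor w i j).smul continuousOn_const
  coordChange_comp i j k x hx v := by
    simp [← densityFactor_comp w i j k hx, mul_assoc]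

variable (n M) in
/-- The bundle `TM(w) = TM ⊗ E(w)` of vector fields of weight `w`. -/
def weightedTangentCore (w : ℝ) :
    VectorBundleCore ℝ M (EuclideanSpace ℝ (Fin n)) (atlas (EuclideanSpace ℝ (Fin n)) M) where
  baseSet i := i.1.source
  isOpen_baseSet i := i.1.open_source
  indexAt := achart (EuclideanSpace ℝ (Fin n))
  mem_baseSet_at := mem_chart_source (EuclideanSpace ℝ (Fin n))
  coordChange i j x := densityFactor w i j x • tangentChange i j x
  coordChange_self i x hx v := by simp [densityFactor_self w i hx, tangentChange_self i hx]
  continuousOn_coordChange i j := (continuousOn_densityFactor w i j).smul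
    ((tangentBundleCore (𝓡 n) M).continuousOn_coordChange i j)
  coordChange_comp i j k x hx v := by
    simp only [smul_apply, map_smul, smul_smul,
      densityFactor_comp w i j k hx, ← tangentChange_comp i j k hx,
      ContinuousLinearMap.comp_apply, mul_comm (densityFactor w i j x)]

variable (M) in
/-- The fibre of `E(w)` at `x`. -/
abbrev Density (n : ℕ) [ChartedSpace (EuclideanSpace ℝ (Fin n)) M] [IsManifold (𝓡 n) ∞ M]
    (w : ℝ) (x : M) : Type := (densityCore n M w).Fiber x

variable (M) in
/-- The fibre of `TM(w)` at `x`. -/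
abbrev WeightedTangent (n : ℕ) [ChartedSpace (EuclideanSpace ℝ (Fin n)) M]
    [IsManifold (𝓡 n) ∞ M] (w : ℝ) (x : M) : Type := (weightedTangentCore n M w).Fiber x

/-- The coordinate function in the chart `i` of a section of `E(w)`. -/
def densityCoord {w : ℝ} (i : atlas (EuclideanSpace ℝ (Fin n)) M) (s : Π x : M, Density M n w x)
    (y : M) : ℝ :=
  (densityCore n M w).coordChange (achart _ y) i y (s y)

/-- The coordinate function in the chart `i` of a section of `TM(w)`. -/
def weightedTangentCoord {w : ℝ} (i : atlas (EuclideanSpace ℝ (Fin n)) M)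
    (s : Π x : M, WeightedTangent M n w x) (y : M) : EuclideanSpace ℝ (Fin n) :=
  (weightedTangentCore n M w).coordChange (achart _ y) i y (s y)

/-- The Christoffel symbol `Γ_{ab}^c X^a v^b` at `x` of `nabla` in the preferred chart at `x`. -/
def christoffel (nabla : AffineConnection n M) (x : M) (X v : TangentSpace (𝓡 n) x) :
    TangentSpace (𝓡 n) x :=
  nabla (FiberBundle.extend (EuclideanSpace ℝ (Fin n)) v) x X

/-- The connection `1`-form `θ_a = Γ_{ab}^b / (n + 1)` at `x` of the connection that `nabla` induces
on `E(1)`, in the trivialization of `E(1)` given by the preferred chart at `x`. -/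
def densityForm (nabla : AffineConnection n M) (x : M) (X : TangentSpace (𝓡 n) x) : ℝ :=
  (∑ i, comp x i (christoffel nabla x X (coordVec x i))) / (n + 1)

/-- The connection on `E(w)` induced by `nabla`, computed at `x` in the preferred chart at `x`. -/
def densityDeriv (nabla : AffineConnection n M) {w : ℝ} (s : Π y : M, Density M n w y) (x : M)
    (X : TangentSpace (𝓡 n) x) : Density M n w x :=
  let ds : ℝ := mfderiv (𝓡 n) 𝓘(ℝ, ℝ) (densityCoord (achart _ x) s) x X
  let s₀ : ℝ := s x
  (ds + w * densityForm nabla x X * s₀ : ℝ)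

/-- The connection on `TM(w) = TM ⊗ E(w)` induced by `nabla`, computed at `x` in the preferred
chart at `x`. -/
def weightedTangentDeriv (nabla : AffineConnection n M) {w : ℝ}
    (s : Π y : M, WeightedTangent M n w y) (x : M) (X : TangentSpace (𝓡 n) x) :
    WeightedTangent M n w x :=
  let ds : EuclideanSpace ℝ (Fin n) :=
    mfderiv (𝓡 n) 𝓘(ℝ, EuclideanSpace ℝ (Fin n)) (weightedTangentCoord (achart _ x) s) x X
  let s₀ : EuclideanSpace ℝ (Fin n) := s x
  let Γs : EuclideanSpace ℝ (Fin n) := christoffel nabla x X s₀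
  (ds + Γs + (w * densityForm nabla x X) • s₀ : EuclideanSpace ℝ (Fin n))

end Density

/-! ### The tractor bundle and the tractor connection -/

section Tractor

/-- The differential at `x`, in the coordinates of the chart `i`, of `log g`, where `g` is the
transition function of `E(1)` from the chart `i` to the chart `j`. -/
def dLogDensity (i j : atlas (EuclideanSpace ℝ (Fin n)) M) (x : M) :
    EuclideanSpace ℝ (Fin n) →L[ℝ] ℝ :=
  fderiv ℝ (fun z => Real.log (densityFactor 1 i j (i.1.symm z))) (i.1 x)

lemma densityFactor_pos (w : ℝ) (i j : atlas (EuclideanSpace ℝ (Fin n)) M) {x : M}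
    (hx : x ∈ i.1.source ∩ j.1.source) : 0 < densityFactor w i j x :=
  Real.rpow_pos_of_pos (abs_pos.2 (det_tangentChange_ne_zero i j hx)) _

lemma contDiff_det :
    ContDiff ℝ ∞ (fun A : EuclideanSpace ℝ (Fin n) →L[ℝ] EuclideanSpace ℝ (Fin n) => A.det) := by
  have h : ∀ A : EuclideanSpace ℝ (Fin n) →L[ℝ] EuclideanSpace ℝ (Fin n), A.det =
      ∑ σ : Equiv.Perm (Fin n), ((Equiv.Perm.sign σ : ℤ) : ℝ) *
        ∏ i, (A (EuclideanSpace.single i 1)) (σ i) := by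
    intro A
    change LinearMap.det (A : EuclideanSpace ℝ (Fin n) →ₗ[ℝ] EuclideanSpace ℝ (Fin n)) = _
    rw [← LinearMap.det_toMatrix (EuclideanSpace.basisFun (Fin n) ℝ).toBasis, Matrix.det_apply']
    simp [LinearMap.toMatrix_apply]
  simp only [h]
  refine ContDiff.sum fun σ _ => contDiff_const.mul (contDiff_prod fun i _ => ?_)
  exact (EuclideanSpace.proj (σ i) : EuclideanSpace ℝ (Fin n) →L[ℝ] ℝ).contDiff.comp
    (ContinuousLinearMap.apply ℝ (EuclideanSpace ℝ (Fin n))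
      (EuclideanSpace.single i (1 : ℝ))).contDiff

lemma contDiffOn_tangentChange (i j : atlas (EuclideanSpace ℝ (Fin n)) M) :
    ContDiffOn ℝ ∞ (fun z => tangentChange i j (i.1.symm z)) (i.1.symm ≫ₕ j.1).source := by
  have h0 : IsManifold (𝓡 n) (∞ + 1) M := by simpa
  have h := contDiffOn_fderiv_coord_change (𝕜 := ℝ) (I := 𝓡 n) (n := ∞) i j
  have hs : ((i.1.extend (𝓡 n)).symm ≫ j.1.extend (𝓡 n)).source = (i.1.symm ≫ₕ j.1).source := by
    simp [mfld_simps]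
  rw [hs] at h
  refine h.congr fun z hz => ?_
  have hz1 : z ∈ i.1.target := by simpa using hz.1
  simp [tangentChange, tangentBundleCore, i.1.right_inv hz1]

lemma mem_overlap (i j : atlas (EuclideanSpace ℝ (Fin n)) M) {z : EuclideanSpace ℝ (Fin n)}
    (hz : z ∈ (i.1.symm ≫ₕ j.1).source) : i.1.symm z ∈ i.1.source ∩ j.1.source := by
  simp only [mfld_simps] at hz
  exact ⟨i.1.map_target hz.1, hz.2⟩

lemma mem_overlap' (i j : atlas (EuclideanSpace ℝ (Fin n)) M) {x : M}
    (hx : x ∈ i.1.source ∩ j.1.source) : i.1 x ∈ (i.1.symm ≫ₕ j.1).source := by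
  simp only [mfld_simps]
  exact ⟨i.1.map_source hx.1, by simpa [i.1.left_inv hx.1] using hx.2⟩

lemma contDiffOn_logDensity (i j : atlas (EuclideanSpace ℝ (Fin n)) M) :
    ContDiffOn ℝ ∞ (fun z => Real.log (densityFactor 1 i j (i.1.symm z)))
      (i.1.symm ≫ₕ j.1).source := by
  have h1 : ContDiffOn ℝ ∞ (fun z => 1 / ((n : ℝ) + 1) *
      Real.log ((tangentChange i j (i.1.symm z)).det)) (i.1.symm ≫ₕ j.1).source :=
    contDiffOn_const.mul ((contDiff_det.comp_contDiffOn (contDiffOn_tangentChange i j)).log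
      fun z hz => det_tangentChange_ne_zero i j (mem_overlap i j hz))
  refine h1.congr fun z hz => ?_
  rw [densityFactor, Real.log_rpow (abs_pos.2 (det_tangentChange_ne_zero i j (mem_overlap i j hz))),
    Real.log_abs]

lemma continuousOn_dLogDensity (i j : atlas (EuclideanSpace ℝ (Fin n)) M) :
    ContinuousOn (dLogDensity i j) (i.1.source ∩ j.1.source) :=
  ((contDiffOn_logDensity i j).continuousOn_fderiv_of_isOpen (i.1.symm ≫ₕ j.1).open_source
    (by simp)).comp (i.1.continuousOn.mono Set.inter_subset_left) fun _ hx => mem_overlap' i j hx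

lemma dLogDensity_self (i : atlas (EuclideanSpace ℝ (Fin n)) M) {x : M} (hx : x ∈ i.1.source) :
    dLogDensity i i x = 0 := by
  have h : (fun z => Real.log (densityFactor 1 i i (i.1.symm z))) =ᶠ[nhds (i.1 x)]
      fun _ => (0 : ℝ) := by
    filter_upwards [i.1.open_target.mem_nhds (i.1.map_source hx)] with z hz
    rw [densityFactor_self 1 i (i.1.map_target hz), Real.log_one]
  rw [dLogDensity, h.fderiv_eq]
  simp

lemma hasFDerivAt_trans (i j : atlas (EuclideanSpace ℝ (Fin n)) M) {x : M}
    (hx : x ∈ i.1.source ∩ j.1.source) :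
    HasFDerivAt (fun z => j.1 (i.1.symm z)) (tangentChange i j x) (i.1 x) := by
  have h := ((𝓡 n).contDiffWithinAt_extendCoordChange' (n := 1)
    (IsManifold.subset_maximalAtlas i.2) (IsManifold.subset_maximalAtlas j.2)
    hx.1 hx.2).differentiableWithinAt one_ne_zero
  have h2 := h.hasFDerivWithinAt
  simpa [tangentChange, tangentBundleCore, Function.comp_def] using h2

lemma dLogDensity_comp (i j k : atlas (EuclideanSpace ℝ (Fin n)) M) {x : M}
    (hx : x ∈ i.1.source ∩ j.1.source ∩ k.1.source) :
    dLogDensity i k x = dLogDensity i j x + (dLogDensity j k x).comp (tangentChange i j x) := by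
  have hij : DifferentiableAt ℝ (fun z => Real.log (densityFactor 1 i j (i.1.symm z))) (i.1 x) :=
    ((contDiffOn_logDensity i j).contDiffAt ((i.1.symm ≫ₕ j.1).open_source.mem_nhds
      (mem_overlap' i j hx.1))).differentiableAt (by simp)
  have hjk : DifferentiableAt ℝ (fun z => Real.log (densityFactor 1 j k (j.1.symm z)))
      (j.1 (i.1.symm (i.1 x))) := by
    rw [i.1.left_inv hx.1.1]
    exact ((contDiffOn_logDensity j k).contDiffAt ((j.1.symm ≫ₕ k.1).open_source.mem_nhds
      (mem_overlap' j k ⟨hx.1.2, hx.2⟩))).differentiableAt (by simp)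
  have hc := hjk.hasFDerivAt.comp (i.1 x) (hasFDerivAt_trans i j hx.1)
  rw [i.1.left_inv hx.1.1] at hc
  refine HasFDerivAt.fderiv ((hij.hasFDerivAt.add hc).congr_of_eventuallyEq ?_)
  filter_upwards [(i.1.symm ≫ₕ j.1).open_source.mem_nhds (mem_overlap' i j hx.1),
    (i.1.symm ≫ₕ k.1).open_source.mem_nhds (mem_overlap' i k ⟨hx.1.1, hx.2⟩)] with z hz hz'
  have h1 := mem_overlap i j hz
  have h2 := mem_overlap i k hz'
  simp only [Pi.add_apply, Function.comp_apply, j.1.left_inv h1.2]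
  rw [← densityFactor_comp 1 i j k ⟨h1, h2.2⟩,
    Real.log_mul (densityFactor_pos 1 j k ⟨h1.2, h2.2⟩).ne' (densityFactor_pos 1 i j h1).ne',
    add_comm]

/-- The transition function of the tractor bundle, the dual of `J¹E(1)`. With `A` and `g` the
transition functions of `TM` and `E(1)`, the `1`-jet `(dσ, σ)` of a section of `E(1)` transforms to
`(d(gσ) ∘ A⁻¹, gσ)`, so that the dual transforms by `(ν, ρ) ↦ (g⁻¹ A ν, g⁻¹ (ρ - (d log g) ν))`
(see `jetPairing_tractorChange`). -/
def tractorChange (i j : atlas (EuclideanSpace ℝ (Fin n)) M) (x : M) :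
    EuclideanSpace ℝ (Fin n) × ℝ →L[ℝ] EuclideanSpace ℝ (Fin n) × ℝ :=
  densityFactor (-1) i j x •
    ((tangentChange i j x).comp (ContinuousLinearMap.fst ℝ _ _)).prod
      (ContinuousLinearMap.snd ℝ _ _ -
        (dLogDensity i j x).comp (ContinuousLinearMap.fst ℝ _ _))

lemma continuousOn_tractorChange (i j : atlas (EuclideanSpace ℝ (Fin n)) M) :
    ContinuousOn (tractorChange i j) (i.1.source ∩ j.1.source) := by
  have hA : ContinuousOn (tangentChange i j) (i.1.source ∩ j.1.source) :=
    (tangentBundleCore (𝓡 n) M).continuousOn_coordChange i j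
  have hl := continuousOn_dLogDensity i j
  have hg := continuousOn_densityFactor (-1) i j
  have h1 := hA.clm_comp (continuousOn_const
    (c := ContinuousLinearMap.fst ℝ (EuclideanSpace ℝ (Fin n)) ℝ))
  have h2 := (continuousOn_const (c := ContinuousLinearMap.snd ℝ (EuclideanSpace ℝ (Fin n)) ℝ)
    (s := i.1.source ∩ j.1.source)).sub (hl.clm_comp (continuousOn_const
    (c := ContinuousLinearMap.fst ℝ (EuclideanSpace ℝ (Fin n)) ℝ)))
  have h3 : Continuous fun q : ((EuclideanSpace ℝ (Fin n) × ℝ) →L[ℝ] EuclideanSpace ℝ (Fin n)) ×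
      ((EuclideanSpace ℝ (Fin n) × ℝ) →L[ℝ] ℝ) => q.1.prod q.2 :=
    (ContinuousLinearMap.prodₗᵢ (𝕜 := ℝ) ℝ).continuous
  exact hg.smul (h3.comp_continuousOn (h1.prodMk h2))

variable (n M) in
/-- The tractor bundle, the dual of the bundle `J¹E(1)` of `1`-jets of sections of `E(1)`. -/
def tractorCore :
    VectorBundleCore ℝ M (EuclideanSpace ℝ (Fin n) × ℝ)
      (atlas (EuclideanSpace ℝ (Fin n)) M) where
  baseSet i := i.1.source
  isOpen_baseSet i := i.1.open_source
  indexAt := achart (EuclideanSpace ℝ (Fin n))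
  mem_baseSet_at := mem_chart_source (EuclideanSpace ℝ (Fin n))
  coordChange := tractorChange
  coordChange_self i x hx v := by
    simp [tractorChange, densityFactor_self (-1) i hx, tangentChange_self i hx,
      dLogDensity_self i hx]
  continuousOn_coordChange := continuousOn_tractorChange
  coordChange_comp i j k x hx v := by
    have hg := densityFactor_comp (-1) i j k hx
    have hA := tangentChange_comp i j k hx
    have hl := dLogDensity_comp i j k hx
    ext1
    · simp [tractorChange, ← hg, ← hA, smul_smul, mul_comm]
    · simp [tractorChange, ← hg, hl]
      ring

variable (M) in
/-- The fibre of the tractor bundle at `x`. -/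
abbrev Tractor (n : ℕ) [ChartedSpace (EuclideanSpace ℝ (Fin n)) M] [IsManifold (𝓡 n) ∞ M]
    (x : M) : Type := (tractorCore n M).Fiber x

/-- The pairing at `x`, in the coordinates of the chart `i`, of the tractor `(ν, ρ)` with the
`1`-jet of a section `s` of `E(1)`. -/
def jetPairing (i : atlas (EuclideanSpace ℝ (Fin n)) M) (x : M)
    (U : EuclideanSpace ℝ (Fin n) × ℝ) (s : Π y : M, Density M n 1 y) : ℝ :=
  fderiv ℝ (fun z => densityCoord i s (i.1.symm z)) (i.1 x) U.1 + U.2 * densityCoord i s x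

/-- The pairing of tractors with `1`-jets of sections of `E(1)` does not depend on the chart. This
identifies the tractor bundle with the dual of `J¹E(1)`. -/
theorem jetPairing_tractorChange (i j : atlas (EuclideanSpace ℝ (Fin n)) M) {x : M}
    (hx : x ∈ i.1.source ∩ j.1.source) (U : EuclideanSpace ℝ (Fin n) × ℝ)
    (s : Π y : M, Density M n 1 y)
    (hs : DifferentiableAt ℝ (fun z => densityCoord j s (j.1.symm z)) (j.1 x)) :
    jetPairing j x (tractorChange i j x U) s = jetPairing i x U s := by
  have hl : DifferentiableAt ℝ (fun z => Real.log (densityFactor 1 i j (i.1.symm z))) (i.1 x) :=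
    ((contDiffOn_logDensity i j).contDiffAt ((i.1.symm ≫ₕ j.1).open_source.mem_nhds
      (mem_overlap' i j hx))).differentiableAt (by simp)
  have hg := densityFactor_pos 1 i j hx
  have hinv : densityFactor (-1) i j x = (densityFactor 1 i j x)⁻¹ := by
    rw [densityFactor, densityFactor, neg_div, Real.rpow_neg (abs_nonneg _)]
  have hs' := hs.hasFDerivAt
  rw [show j.1 x = j.1 (i.1.symm (i.1 x)) by rw [i.1.left_inv hx.1]] at hs'
  have hc := hs'.comp (i.1 x) (hasFDerivAt_trans i j hx)
  have he := hl.hasFDerivAt.neg.exp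
  have hp := he.mul hc
  have hco : ∀ y ∈ i.1.source ∩ j.1.source,
      densityCoord i s y = Real.exp (-Real.log (densityFactor 1 i j y)) * densityCoord j s y := by
    intro y hy
    have h1 : densityCoord j s y = densityFactor 1 i j y * densityCoord i s y :=
      ((densityCore n M 1).coordChange_comp (achart _ y) i j y
        ⟨⟨mem_chart_source _ y, hy.1⟩, hy.2⟩ (s y)).symm
    rw [Real.exp_neg, Real.exp_log (densityFactor_pos 1 i j hy), h1,
      inv_mul_cancel_left₀ (densityFactor_pos 1 i j hy).ne']
  have hd := (hp.congr_of_eventuallyEq (f₁ := fun z => densityCoord i s (i.1.symm z)) (by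
    filter_upwards [(i.1.symm ≫ₕ j.1).open_source.mem_nhds (mem_overlap' i j hx)] with z hz
    have h1 := mem_overlap i j hz
    simp only [Pi.mul_apply, Function.comp_apply, j.1.left_inv h1.2]
    exact hco _ h1)).fderiv
  simp only [jetPairing, hd, hco x hx, tractorChange, hinv, dLogDensity, Pi.neg_apply,
    i.1.left_inv hx.1, Real.exp_neg, Real.exp_log hg, Function.comp_apply, j.1.left_inv hx.2]
  simp
  ring

/-- The projection `(ν, ρ) ↦ ν` of the tractor bundle onto `TM(-1)`. -/
def projTangent (U : Π y : M, Tractor M n y) (y : M) : WeightedTangent M n (-1) y :=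
  (show EuclideanSpace ℝ (Fin n) × ℝ from U y).1

/-- The projection of the tractor bundle onto `E(-1)` that `nabla` determines: it is dual to the
map that sends `σ` in `E(1)` to the `1`-jet at `y` with value `σ` and vanishing `nabla`-derivative,
which is `(-σ θ, σ)` in the preferred chart at `y`. -/
def projDensity (nabla : AffineConnection n M) (U : Π y : M, Tractor M n y) (y : M) :
    Density M n (-1) y :=
  let ν : EuclideanSpace ℝ (Fin n) := (show EuclideanSpace ℝ (Fin n) × ℝ from U y).1
  let ρ : ℝ := (show EuclideanSpace ℝ (Fin n) × ℝ from U y).2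
  (ρ - densityForm nabla y ν : ℝ)

/-- The tractor at `y` with components `(ν, ρ)` in `TM(-1) ⊕ E(-1)` in the splitting that `nabla`
determines. -/
def ofSplitting (nabla : AffineConnection n M) (y : M) (ν : WeightedTangent M n (-1) y)
    (ρ : Density M n (-1) y) : Tractor M n y :=
  let ν₀ : EuclideanSpace ℝ (Fin n) := ν
  let ρ₀ : ℝ := ρ
  ((ν₀, ρ₀ + densityForm nabla y ν₀) : EuclideanSpace ℝ (Fin n) × ℝ)

/-- The projective tractor connection, computed in the splitting that `nabla` determines:
`∇_a (ν^b, ρ) = (∇_a ν^b + ρ δ_a^b, ∇_a ρ - P_{ab} ν^b)`. -/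
def tractorConnection (nabla : AffineConnection n M) (U : Π y : M, Tractor M n y) (x : M)
    (X : TangentSpace (𝓡 n) x) : Tractor M n x :=
  let ν := projTangent U
  let ρ := projDensity nabla U
  let ρX : WeightedTangent M n (-1) x := (show ℝ from ρ x) • (show EuclideanSpace ℝ (Fin n) from X)
  let Pν : Density M n (-1) x := schouten nabla x X (show EuclideanSpace ℝ (Fin n) from ν x)
  ofSplitting nabla x (weightedTangentDeriv nabla ν x X + ρX) (densityDeriv nabla ρ x X - Pν)

/-- The forms `p_k` of an affine connection. -/
def p (nabla : AffineConnection n M) (k : ℕ) (x : M)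
    (v : Fin (2 * k) → TangentSpace (𝓡 n) x) : ℝ :=
  curvatureForm (EuclideanSpace ℝ (Fin n)) nabla.deriv k x v

/-- The forms `q_k` of the tractor connection, computed in the splitting that `nabla`
determines. -/
def q (nabla : AffineConnection n M) (k : ℕ) (x : M)
    (v : Fin (2 * k) → TangentSpace (𝓡 n) x) : ℝ :=
  curvatureForm (EuclideanSpace ℝ (Fin n) × ℝ) (tractorConnection nabla) k x v

end Tractor

end ProjectiveTractor

end

/-! Everything is expressed through the Thomas symbols. In a chart let `Γ` be the Christoffel
symbols of a Weyl connection, `θ = tr Γ / (n + 1)`, and `Π(X, v) = Γ(X, v) - θ(X) v - θ(v) X`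
(`thomas`). A projective change adds `Υ` to `θ` and leaves `Π` alone. Let `W` be the curvature of `d
+ Π`. It satisfies the Bianchi identity and, as `Π` is trace free, has zero trace, so its Ricci
contraction is symmetric. Put `Q = Ric(W) / (n - 1)` (`rhoForm`).

With `K = ∇θ + θ ⊗ θ` (`thetaForm`) one finds `R(X, Y)v = W(X, Y)v + K(X, v)Y - K(Y, v)X + (K(X, Y)
- K(Y, X))v` and `P = Q - K` (`flatCurvature_eq_thomas`, `schoutenForm_eq`). Read in the chart
coordinates of the dual of `J¹E(1)`, the tractor connection is therefore `d + A` with `A(X)(ν, ρ) =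
(Π(X, ν) + ρX, -Q(X, ν))` (`hasConnectionForm_tractorConnection`). Only `Π` enters, which is the
invariance.

Since `Π` and `Q` are symmetric, the tractor curvature kills the vector `(0, 1)`. Traces of products
then only see the block on `TM`, which is `W + Q ∧ id` (`flatCurvature_tractorForm`,
`trace_list_prod_block`). For a scale connection `P` is symmetric, hence so is `K`, and `R = W + K ∧
id`.

It remains that adding `K ∧ id` with `K` symmetric does not change the skewed trace of a power of
`W` (`skewTrace_add_wedgeId`). Each such term contains a rank one factor whose vector is one of the
form arguments. The preceding factor acts on that vector, and skewing over it and the two form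
arguments of that factor gives zero by Bianchi. So both `p_k` and `q_k` are the skewed trace of
`W^k`. -/

open scoped Manifold ContDiff Bundle

set_option synthInstance.maxHeartbeats 200000
set_option maxHeartbeats 1000000

noncomputable section

namespace ProjectiveTractor

/-! ### Skewed traces of products of endomorphism valued 2-forms -/

section SkewTrace

theorem sum_sign_mul_eq_zero_of_cyclic {m : ℕ} (f : Equiv.Perm (Fin m) → ℝ)
    (c : Equiv.Perm (Fin m)) (hc : Equiv.Perm.sign c = 1)
    (h : ∀ τ, f τ + f (τ * c) + f (τ * c * c) = 0) :
    ∑ τ, ((Equiv.Perm.sign τ : ℤ) : ℝ) * f τ = 0 := by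
  -- Right translation by the even permutation `c` is a bijection that preserves signs, so the three
  -- terms in `h` have the same signed sum.
  have key : ∀ g : Equiv.Perm (Fin m) → ℝ, ∑ τ, ((Equiv.Perm.sign τ : ℤ) : ℝ) * g (τ * c) =
      ∑ τ, ((Equiv.Perm.sign τ : ℤ) : ℝ) * g τ := fun g => by
    rw [← Equiv.sum_comp (Equiv.mulRight c) fun τ => ((Equiv.Perm.sign τ : ℤ) : ℝ) * g τ]
    simp [hc]
  have h1 := key f
  have h2 := key fun τ => f (τ * c)
  have h3 : ∑ τ, ((Equiv.Perm.sign τ : ℤ) : ℝ) * (f τ + f (τ * c) + f (τ * c * c)) = 0 := by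
    simp [h]
  simp only [mul_add, Finset.sum_add_distrib] at h3
  linarith

variable {E : Type*} [AddCommGroup E] [Module ℝ E]

/-- In a trace of a product, a factor and its cyclic predecessor can be brought to the front. -/
theorem exists_trace_prod_ofFn_eq {k : ℕ} (hk : 2 ≤ k) (i : Fin k) :
    ∃ i' : Fin k, i' ≠ i ∧ ∀ C : Fin k → Module.End ℝ E, ∃ Z : Module.End ℝ E,
      ∀ D : Fin k → Module.End ℝ E, (∀ j, j ≠ i → j ≠ i' → D j = C j) →
        LinearMap.trace ℝ E (List.ofFn D).prod = LinearMap.trace ℝ E (D i' * D i * Z) := by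
  obtain ⟨i, hi⟩ := i
  rcases Nat.eq_zero_or_pos i with rfl | hpos
  -- The cyclic predecessor of the first factor is the last one, distinct from it because `2 ≤ k`.
  -- `Z` is the product of the factors in between.
  · obtain ⟨l, rfl⟩ : ∃ l, k = l + 2 := ⟨k - 2, by omega⟩
    refine ⟨Fin.last _, by simp [Fin.ext_iff],
      fun C => ⟨(List.ofFn fun j : Fin l => C j.succ.castSucc).prod, fun D hD => ?_⟩⟩
    have hm : (fun j : Fin l => D j.succ.castSucc) = fun j => C j.succ.castSucc := by
      funext j
      refine hD _ (by simp [Fin.ext_iff]) (Fin.castSucc_lt_last _).ne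
    rw [List.ofFn_succ', List.prod_concat, List.ofFn_succ, List.prod_cons, LinearMap.trace_mul_comm,
      ← mul_assoc]
    simp only [← Fin.succ_castSucc] at hm ⊢
    rw [hm]
    rfl
  -- Here the factors before the pair are moved cyclically behind the factors after it.
  · obtain ⟨a, rfl⟩ : ∃ a, i = a + 1 := ⟨i - 1, by omega⟩
    have ha : a < k := by omega
    refine ⟨⟨a, ha⟩, by simp, fun C => ⟨((List.ofFn C).drop (a + 2)).prod *
      ((List.ofFn C).take a).prod, fun D hD => ?_⟩⟩
    have h1 : (List.ofFn D).take a = (List.ofFn C).take a := by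
      refine List.ext_getElem (by simp) fun j h1 h2 => ?_
      simp only [List.length_take, List.length_ofFn, lt_min_iff] at h1
      simp only [List.getElem_take, List.getElem_ofFn]
      exact hD _ (by simp [Fin.ext_iff]; omega) (by simp [Fin.ext_iff]; omega)
    have h2 : (List.ofFn D).drop (a + 2) = (List.ofFn C).drop (a + 2) := by
      refine List.ext_getElem (by simp) fun j h1 h2 => ?_
      simp only [List.getElem_drop, List.getElem_ofFn]
      exact hD _ (by simp [Fin.ext_iff]; omega) (by simp [Fin.ext_iff]; omega)
    have h3 : List.ofFn D = (List.ofFn D).take a ++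
        D ⟨a, ha⟩ :: D ⟨a + 1, hi⟩ :: (List.ofFn D).drop (a + 2) := by
      conv_lhs => rw [← List.take_append_drop a (List.ofFn D),
        List.drop_eq_getElem_cons (by simpa using ha),
        List.drop_eq_getElem_cons (by simpa using hi)]
      simp
    rw [h3, List.prod_append, h1, h2, LinearMap.trace_mul_comm]
    simp [mul_assoc]

/-- The sum over all permutations, with signs, of the traces of the products of the `2`-forms
`B 0, …, B (k - 1)` evaluated on the permuted vectors. -/
def skewTrace {k : ℕ} (B : Fin k → E → E → Module.End ℝ E) (v : Fin (2 * k) → E) : ℝ :=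
  ∑ τ : Equiv.Perm (Fin (2 * k)), ((Equiv.Perm.sign τ : ℤ) : ℝ) * LinearMap.trace ℝ E
    (List.ofFn fun i : Fin k => B i (v (τ ⟨2 * i, by omega⟩)) (v (τ ⟨2 * i + 1, by omega⟩))).prod

/-- Because the slots may carry different forms, the passage from `F` to `F + wedgeId K` can be made
one slot at a time. -/
theorem skewTrace_update_add {k : ℕ} (B : Fin k → E → E → Module.End ℝ E) (i : Fin k)
    (F G : E → E → Module.End ℝ E) (v : Fin (2 * k) → E) :
    skewTrace (Function.update B i (F + G)) v =
      skewTrace (Function.update B i F) v + skewTrace (Function.update B i G) v := by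
  simp only [skewTrace, ← Finset.sum_add_distrib, ← mul_add, ← map_add]
  refine Finset.sum_congr rfl fun τ _ => ?_
  have hu : ∀ H : E → E → Module.End ℝ E,
      (fun j : Fin k => Function.update B i H j (v (τ ⟨2 * j, by omega⟩))
        (v (τ ⟨2 * j + 1, by omega⟩))) =
      Function.update (fun j : Fin k => B j (v (τ ⟨2 * j, by omega⟩))
        (v (τ ⟨2 * j + 1, by omega⟩))) i
        (H (v (τ ⟨2 * i, by omega⟩)) (v (τ ⟨2 * i + 1, by omega⟩))) := by
    intro H
    funext j
    by_cases hj : j = i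
    · subst hj; simp
    · simp [hj]
  have := (MultilinearMap.mkPiAlgebraFin ℝ k (Module.End ℝ E)).map_update_add
    (fun j : Fin k => B j (v (τ ⟨2 * j, by omega⟩)) (v (τ ⟨2 * j + 1, by omega⟩))) i
    (F (v (τ ⟨2 * i, by omega⟩)) (v (τ ⟨2 * i + 1, by omega⟩)))
    (G (v (τ ⟨2 * i, by omega⟩)) (v (τ ⟨2 * i + 1, by omega⟩)))
  simp only [MultilinearMap.mkPiAlgebraFin_apply] at this
  rw [hu, hu, hu, ← this]
  rfl

/-- The algebraic Bianchi identity. -/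
def IsBianchi (F : E → E → Module.End ℝ E) : Prop :=
  ∀ a b c, F a b c + F b c a + F c a b = 0

variable [FiniteDimensional ℝ E]

/-- By cyclicity the trace against a rank one factor becomes an evaluation in which the preceding
factor `A` acts directly on `d`. The Bianchi identity for `A` can then be applied. -/
theorem trace_mul_smulRight_mul (A Z : Module.End ℝ E) (φ : Module.Dual ℝ E) (d : E) :
    LinearMap.trace ℝ E (A * φ.smulRight d * Z) = φ (Z (A d)) := by
  rw [LinearMap.trace_mul_comm, ← mul_assoc]
  have : Z * A * φ.smulRight d = φ.smulRight (Z (A d)) := by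
    ext w; simp
  rw [this, LinearMap.trace_smulRight]

/-- A rank one factor whose vector slot is one of its two form slots makes the skew trace vanish,
by the Bianchi identity for the preceding factor. -/
theorem skewTrace_eq_zero {k : ℕ} (hk : 2 ≤ k) (B : Fin k → E → E → Module.End ℝ E) (i : Fin k)
    (hB : ∀ j, j ≠ i → IsBianchi (B j)) (φ : E → Module.Dual ℝ E)
    (hi : (∀ c d, B i c d = (φ c).smulRight d) ∨ (∀ c d, B i c d = (φ d).smulRight c))
    (v : Fin (2 * k) → E) : skewTrace B v = 0 := by
  obtain ⟨i', hne, hZ⟩ := exists_trace_prod_ofFn_eq (E := E) hk i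
  have hne' : (i' : ℕ) ≠ i := fun h => hne (Fin.ext h)
  choose Z hZ using hZ
  set C : Equiv.Perm (Fin (2 * k)) → Fin k → Module.End ℝ E := fun τ j =>
    B j (v (τ ⟨2 * j, by omega⟩)) (v (τ ⟨2 * j + 1, by omega⟩)) with hC
  -- `s` is the slot that supplies the vector of the rank one factor and `t` the slot that supplies
  -- its covector. The two alternatives in `hi` differ only in which is which.
  have main : ∀ (s t : Fin (2 * k)), (∀ τ, C τ i = (φ (v (τ t))).smulRight (v (τ s))) →
      (s = ⟨2 * i, by omega⟩ ∧ t = ⟨2 * i + 1, by omega⟩ ∨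
        s = ⟨2 * i + 1, by omega⟩ ∧ t = ⟨2 * i, by omega⟩) → skewTrace B v = 0 := by
    intro s t hs hst
    have hts : t ≠ s := by rcases hst with ⟨rfl, rfl⟩ | ⟨rfl, rfl⟩ <;> simp
    let p : Fin (2 * k) := ⟨2 * i', by omega⟩
    let q : Fin (2 * k) := ⟨2 * i' + 1, by omega⟩
    have hpq : p ≠ q := by simp [p, q]
    have hps : p ≠ s := by rcases hst with ⟨rfl, _⟩ | ⟨rfl, _⟩ <;> simp [p] <;> omega
    have hqs : q ≠ s := by rcases hst with ⟨rfl, _⟩ | ⟨rfl, _⟩ <;> simp [q] <;> omega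
    have htp : t ≠ p := by rcases hst with ⟨_, rfl⟩ | ⟨_, rfl⟩ <;> simp [p] <;> omega
    have htq : t ≠ q := by rcases hst with ⟨_, rfl⟩ | ⟨_, rfl⟩ <;> simp [q] <;> omega
    -- The 3-cycle `p → q → s → p` through the two form slots of the preceding factor and the vector
    -- slot. It fixes `t` and all slots of the other factors, so the same `Z` serves all three
    -- translates.
    let c : Equiv.Perm (Fin (2 * k)) := Equiv.swap p q * Equiv.swap q s
    have hcp : c p = q := by
      simp [c, Equiv.swap_apply_of_ne_of_ne hpq hps]
    have hcq : c q = s := by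
      simp [c, Equiv.swap_apply_of_ne_of_ne hps.symm hqs.symm]
    have hcs : c s = p := by simp [c]
    have hc : ∀ x, x ≠ p → x ≠ q → x ≠ s → c x = x := by
      intro x h1 h2 h3
      simp [c, Equiv.swap_apply_of_ne_of_ne h2 h3, Equiv.swap_apply_of_ne_of_ne h1 h2]
    have hCc : ∀ τ j, j ≠ i → j ≠ i' → C (τ * c) j = C τ j := by
      intro τ j h1 h2
      have h1' : (j : ℕ) ≠ i := fun h => h1 (Fin.ext h)
      have h2' : (j : ℕ) ≠ i' := fun h => h2 (Fin.ext h)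
      have e1 : c ⟨2 * j, by omega⟩ = ⟨2 * j, by omega⟩ := by
        refine hc _ (by simp [p]; omega) (by simp [q]; omega) ?_
        rcases hst with ⟨rfl, _⟩ | ⟨rfl, _⟩ <;> simp <;> omega
      have e2 : c ⟨2 * j + 1, by omega⟩ = ⟨2 * j + 1, by omega⟩ := by
        refine hc _ (by simp [p]; omega) (by simp [q]; omega) ?_
        rcases hst with ⟨rfl, _⟩ | ⟨rfl, _⟩ <;> simp <;> omega
      simp only [hC, Equiv.Perm.mul_apply, e1, e2]
    refine sum_sign_mul_eq_zero_of_cyclic _ c ?_ fun τ => ?_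
    · simp [c, Equiv.Perm.sign_swap hpq, Equiv.Perm.sign_swap hqs]
    · change LinearMap.trace ℝ E (List.ofFn (C τ)).prod +
        LinearMap.trace ℝ E (List.ofFn (C (τ * c))).prod +
        LinearMap.trace ℝ E (List.ofFn (C (τ * c * c))).prod = 0
      rw [hZ (C τ) (C τ) fun _ _ _ => rfl, hZ (C τ) (C (τ * c)) (hCc τ),
        hZ (C τ) (C (τ * c * c)) fun j h1 h2 => (hCc _ j h1 h2).trans (hCc τ j h1 h2)]
      simp only [hs, trace_mul_smulRight_mul]
      have e : ∀ σ : Equiv.Perm (Fin (2 * k)), C σ i' = B i' (v (σ p)) (v (σ q)) := fun σ => rfl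
      simp only [e, Equiv.Perm.mul_apply, hcp, hcq, hcs, hc t htp htq hts]
      have hb := hB i' hne (v (τ p)) (v (τ q)) (v (τ s))
      have := congrArg (fun w => φ (v (τ t)) (Z (C τ) w)) hb
      simp only [map_add, map_zero] at this
      linarith
  rcases hi with hi | hi
  · exact main ⟨2 * i + 1, by omega⟩ ⟨2 * i, by omega⟩ (fun τ => hi _ _) (Or.inr ⟨rfl, rfl⟩)
  · exact main ⟨2 * i, by omega⟩ ⟨2 * i + 1, by omega⟩ (fun τ => hi _ _) (Or.inl ⟨rfl, rfl⟩)

/-- The endomorphism valued `2`-form `(c, d) ↦ K(c, ·) d - K(d, ·) c`. -/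
def wedgeId (K : E →ₗ[ℝ] E →ₗ[ℝ] ℝ) (c d : E) : Module.End ℝ E :=
  (K c).smulRight d + (-K d).smulRight c

omit [FiniteDimensional ℝ E] in
theorem wedgeId_apply (K : E →ₗ[ℝ] E →ₗ[ℝ] ℝ) (c d w : E) :
    wedgeId K c d w = K c w • d - K d w • c := by
  simp [wedgeId, sub_eq_add_neg]

omit [FiniteDimensional ℝ E] in
-- In the cyclic sum each of the three vectors occurs with `K` of the other two in both orders and
-- opposite signs.
theorem IsBianchi.add_wedgeId {F : E → E → Module.End ℝ E} (hF : IsBianchi F)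
    {K : E →ₗ[ℝ] E →ₗ[ℝ] ℝ} (hK : ∀ a b, K a b = K b a) :
    IsBianchi (fun c d => F c d + wedgeId K c d) := by
  intro a b c
  have h := hF a b c
  simp only [LinearMap.add_apply, wedgeId_apply]
  rw [hK b a, hK c a, hK c b]
  rw [← h]
  abel

/-- This settles `k = 1`, where no preceding factor is available for the Bianchi argument. -/
theorem trace_wedgeId {K : E →ₗ[ℝ] E →ₗ[ℝ] ℝ} (hK : ∀ a b, K a b = K b a) (c d : E) :
    LinearMap.trace ℝ E (wedgeId K c d) = 0 := by
  simp [wedgeId, LinearMap.trace_smulRight, hK c d]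

/-- The skew trace of the powers of a `2`-form that satisfies the Bianchi identity does not change
when the wedge product of the identity with a symmetric bilinear form is added. -/
theorem skewTrace_add_wedgeId {k : ℕ} (hk : 1 ≤ k) {F : E → E → Module.End ℝ E}
    (hF : IsBianchi F) {K : E →ₗ[ℝ] E →ₗ[ℝ] ℝ} (hK : ∀ a b, K a b = K b a)
    (v : Fin (2 * k) → E) :
    skewTrace (fun _ : Fin k => fun c d => F c d + wedgeId K c d) v =
      skewTrace (fun _ : Fin k => F) v := by
  classical
  set G : E → E → Module.End ℝ E := fun c d => F c d + wedgeId K c d with hG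
  have hGb : IsBianchi G := hF.add_wedgeId hK
  rcases hk.eq_or_lt with rfl | hk
  · unfold skewTrace
    refine Finset.sum_congr rfl fun τ _ => ?_
    simp [hG, trace_wedgeId hK]
  -- Induction on the set of slots already carrying `G`. Mixed products are harmless since `F` and
  -- `G` both satisfy Bianchi, and the two summands of `wedgeId K` are the two rank one shapes of
  -- `skewTrace_eq_zero`.
  have step : ∀ s : Finset (Fin k),
      skewTrace (fun j => if j ∈ s then G else F) v = skewTrace (fun _ : Fin k => F) v := by
    intro s
    induction s using Finset.induction_on with
    | empty => simp
    | insert i s hi ih =>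
      set B : Fin k → E → E → Module.End ℝ E := fun j => if j ∈ s then G else F with hB
      have hBb : ∀ j, IsBianchi (B j) := fun j => by
        by_cases h : j ∈ s <;> simp [hB, h, hF, hGb]
      have e1 : (fun j => if j ∈ insert i s then G else F) = Function.update B i
          (F + ((fun c d => (K c).smulRight d) + fun c d => (-K d).smulRight c)) := by
        funext j
        by_cases hj : j = i
        · subst hj; simp [hG]; rfl
        · simp [hj, hB]
      have e2 : Function.update B i F = B := by
        rw [Function.update_eq_self_iff]; simp [hB, hi]
      have hz : ∀ N : E → E → Module.End ℝ E, ∀ φ : E → Module.Dual ℝ E,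
          ((∀ c d, N c d = (φ c).smulRight d) ∨ (∀ c d, N c d = (φ d).smulRight c)) →
          skewTrace (Function.update B i N) v = 0 := by
        intro N φ hN
        refine skewTrace_eq_zero hk _ i (fun j hj => ?_) φ ?_ v
        · simpa [hj] using hBb j
        · simpa using hN
      rw [e1, skewTrace_update_add, skewTrace_update_add, e2, ih,
        hz _ (fun c => K c) (Or.inl fun _ _ => rfl),
        hz _ (fun d => -K d) (Or.inr fun _ _ => rfl)]
      simp
  simpa using step Finset.univ

end SkewTrace

end ProjectiveTractor

end

noncomputable section

namespace ProjectiveTractor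

/-! ### Connections `d + A` on a vector space, Thomas symbols and the tractor connection form -/

section Flat

section Instances

variable {E F G H : Type*} [NormedAddCommGroup E] [NormedSpace ℝ E] [NormedAddCommGroup F]
  [NormedSpace ℝ F] [NormedAddCommGroup G] [NormedSpace ℝ G] [NormedAddCommGroup H]
  [NormedSpace ℝ H]

instance instNormedAddCommGroupCLM₂ : NormedAddCommGroup (E →L[ℝ] F →L[ℝ] G) :=
  ContinuousLinearMap.toNormedAddCommGroup

instance instNormedSpaceCLM₂ : NormedSpace ℝ (E →L[ℝ] F →L[ℝ] G) :=
  ContinuousLinearMap.toNormedSpace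

instance instNormedAddCommGroupCLM₃ : NormedAddCommGroup (E →L[ℝ] F →L[ℝ] G →L[ℝ] H) :=
  ContinuousLinearMap.toNormedAddCommGroup

instance instNormedSpaceCLM₃ : NormedSpace ℝ (E →L[ℝ] F →L[ℝ] G →L[ℝ] H) :=
  ContinuousLinearMap.toNormedSpace

end Instances

variable {E : Type*} [NormedAddCommGroup E] [NormedSpace ℝ E]
  {G : Type*} [NormedAddCommGroup G] [NormedSpace ℝ G]

theorem fderiv_clm_apply_const {A : E → E →L[ℝ] G →L[ℝ] G} {z : E} (hA : DifferentiableAt ℝ A z)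
    (X Y : E) (w : G) : fderiv ℝ A z X Y w = fderiv ℝ (fun z' => A z' Y w) z X := by
  have h := (hA.hasFDerivAt.clm_apply (hasFDerivAt_const Y z)).clm_apply (hasFDerivAt_const w z)
  rw [h.fderiv]
  simp

/-- The curvature of the connection `d + A` on a trivial bundle. -/
def flatCurvature (A : E → E →L[ℝ] G →L[ℝ] G) (z : E) : E →L[ℝ] E →L[ℝ] G →L[ℝ] G :=
  let C := ((ContinuousLinearMap.compL ℝ E (G →L[ℝ] G) (G →L[ℝ] G)).flip (A z)).comp
    ((ContinuousLinearMap.compL ℝ G G G).comp (A z))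
  fderiv ℝ A z - (fderiv ℝ A z).flip + C - C.flip

theorem flatCurvature_apply (A : E → E →L[ℝ] G →L[ℝ] G) (z X Y : E) (w : G) :
    flatCurvature A z X Y w =
      fderiv ℝ A z X Y w - fderiv ℝ A z Y X w + A z X (A z Y w) - A z Y (A z X w) := by
  simp [flatCurvature]

theorem contDiffAt_bilinear_comp {A : E → E →L[ℝ] G} {z : E} (m : G →L[ℝ] G →L[ℝ] G)
    (hA : ContDiffAt ℝ ∞ A z) : ContDiffAt ℝ ∞
      (fun z => ((ContinuousLinearMap.compL ℝ E G G).flip (A z)).comp (m.comp (A z))) z := by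
  have h2 : ContDiffAt ℝ ∞ (fun z => m.comp (A z)) z := contDiffAt_const.clm_comp hA
  have h3 : ContDiffAt ℝ ∞ (fun z => (ContinuousLinearMap.compL ℝ E G G).flip (A z)) z :=
    contDiffAt_const.clm_apply hA
  exact h3.clm_comp h2

theorem contDiffAt_flip {D : E → E →L[ℝ] E →L[ℝ] G} {z : E} (hD : ContDiffAt ℝ ∞ D z) :
    ContDiffAt ℝ ∞ (fun z' => (D z').flip) z :=
  (ContinuousLinearMap.flipₗᵢ ℝ E E G).contDiff.contDiffAt.comp z hD

theorem contDiffAt_flatCurvature {A : E → E →L[ℝ] G →L[ℝ] G} {z : E} (hA : ContDiffAt ℝ ∞ A z) :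
    ContDiffAt ℝ ∞ (flatCurvature A) z := by
  have h1 : ContDiffAt ℝ ∞ (fderiv ℝ A) z := hA.fderiv_right (by simp)
  have hC := contDiffAt_bilinear_comp (ContinuousLinearMap.compL ℝ G G G) hA
  exact ((h1.sub (contDiffAt_flip h1)).add hC).sub (contDiffAt_flip hC)

theorem flatCurvature_congr {A A' : E → E →L[ℝ] G →L[ℝ] G} {z : E} (h : A =ᶠ[nhds z] A') :
    flatCurvature A z = flatCurvature A' z := by
  simp only [flatCurvature, h.fderiv_eq, h.eq_of_nhds]

theorem flatCurvature_swap (A : E → E →L[ℝ] G →L[ℝ] G) (z X Y : E) (w : G) :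
    flatCurvature A z X Y w = -flatCurvature A z Y X w := by
  simp only [flatCurvature_apply]
  abel

theorem fderiv_apply_symm {A : E → E →L[ℝ] E →L[ℝ] E} {z : E} (hA : DifferentiableAt ℝ A z)
    (hs : ∀ᶠ z' in nhds z, ∀ X v, A z' X v = A z' v X) (X Y v : E) :
    fderiv ℝ A z X Y v = fderiv ℝ A z X v Y := by
  rw [fderiv_clm_apply_const hA, fderiv_clm_apply_const hA]
  refine congrArg (fun D : E →L[ℝ] E => D X) (Filter.EventuallyEq.fderiv_eq ?_)
  filter_upwards [hs] with z' h using h Y v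

/-- Symmetry of `A` near `z`, and not only at `z`, makes its derivative symmetric in the last two
slots. The derivative terms and the quadratic terms then cancel in pairs. -/
theorem flatCurvature_bianchi {A : E → E →L[ℝ] E →L[ℝ] E} {z : E} (hA : DifferentiableAt ℝ A z)
    (hs : ∀ᶠ z' in nhds z, ∀ X v, A z' X v = A z' v X) (X Y v : E) :
    flatCurvature A z X Y v + flatCurvature A z Y v X + flatCurvature A z v X Y = 0 := by
  have h0 := hs.self_of_nhds
  simp only [flatCurvature_apply]
  rw [fderiv_apply_symm hA hs X v Y, fderiv_apply_symm hA hs Y v X, fderiv_apply_symm hA hs v Y X,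
    h0 Y v, h0 v X, h0 X Y]
  abel

variable [FiniteDimensional ℝ E]

variable (E) in
/-- The trace as a continuous linear form. -/
def traceL : (E →L[ℝ] E) →L[ℝ] ℝ :=
  LinearMap.toContinuousLinearMap ((LinearMap.trace ℝ E).comp (ContinuousLinearMap.coeLM ℝ))

theorem traceL_apply (A : E →L[ℝ] E) : traceL E A = LinearMap.trace ℝ E (A : E →ₗ[ℝ] E) := rfl

theorem traceL_comm (A B : E →L[ℝ] E) : traceL E (A.comp B) = traceL E (B.comp A) :=
  LinearMap.trace_mul_comm ℝ (A : Module.End ℝ E) (B : Module.End ℝ E)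

theorem traceL_smulRight (φ : E →L[ℝ] ℝ) (v : E) : traceL E (φ.smulRight v) = φ v :=
  LinearMap.trace_smulRight (φ : Module.Dual ℝ E) v

theorem traceL_id : traceL E (ContinuousLinearMap.id ℝ E) = Module.finrank ℝ E :=
  LinearMap.trace_id ℝ E

theorem traceL_conj (e : E ≃L[ℝ] E) (A : E →L[ℝ] E) :
    traceL E (((e : E →L[ℝ] E).comp A).comp (e.symm : E →L[ℝ] E)) = traceL E A := by
  rw [traceL_comm, ← ContinuousLinearMap.comp_assoc]
  simp

/-- The `1`-form `θ = tr Γ / (n + 1)`. -/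
def traceForm (Γ : E → E →L[ℝ] E →L[ℝ] E) (z : E) : E →L[ℝ] ℝ :=
  ((Module.finrank ℝ E : ℝ) + 1)⁻¹ • (traceL E).comp (Γ z)

/-- The bilinear map `θ ↦ ((X, v) ↦ θ(X) v + θ(v) X)`. -/
def symMap (θ : E →L[ℝ] ℝ) : E →L[ℝ] E →L[ℝ] E :=
  θ.smulRight (ContinuousLinearMap.id ℝ E) + (θ.smulRight (ContinuousLinearMap.id ℝ E)).flip

omit [FiniteDimensional ℝ E] in
theorem symMap_apply (θ : E →L[ℝ] ℝ) (X v : E) : symMap θ X v = θ X • v + θ v • X := by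
  simp [symMap]

theorem traceL_symMap (θ : E →L[ℝ] ℝ) (X : E) :
    traceL E (symMap θ X) = (Module.finrank ℝ E + 1) * θ X := by
  have : symMap θ X = θ X • ContinuousLinearMap.id ℝ E + θ.smulRight X := by
    ext v; simp [symMap_apply]
  rw [this, map_add, map_smul, traceL_id, traceL_smulRight, smul_eq_mul]
  ring

/-- The Thomas symbols, the trace free part of the Christoffel symbols. -/
def thomas (Γ : E → E →L[ℝ] E →L[ℝ] E) (z : E) : E →L[ℝ] E →L[ℝ] E :=
  Γ z - symMap (traceForm Γ z)

theorem thomas_apply (Γ : E → E →L[ℝ] E →L[ℝ] E) (z X v : E) :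
    thomas Γ z X v = Γ z X v - (traceForm Γ z X • v + traceForm Γ z v • X) := by
  simp [thomas, symMap_apply]

theorem eq_thomas_add (Γ : E → E →L[ℝ] E →L[ℝ] E) (z X v : E) :
    Γ z X v = thomas Γ z X v + traceForm Γ z X • v + traceForm Γ z v • X := by
  rw [thomas_apply]; abel

theorem traceL_thomas (Γ : E → E →L[ℝ] E →L[ℝ] E) (z X : E) : traceL E (thomas Γ z X) = 0 := by
  have h : ((Module.finrank ℝ E : ℝ) + 1) ≠ 0 := by positivity
  simp [thomas, traceL_symMap, traceForm, h]

/-- The Thomas symbols are projectively invariant. -/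
theorem thomas_eq_of_projective {Γ Γ' : E → E →L[ℝ] E →L[ℝ] E} {z : E} (Υ : E →L[ℝ] ℝ)
    (h : ∀ X v, Γ' z X v = Γ z X v + Υ X • v + Υ v • X) : thomas Γ' z = thomas Γ z := by
  have h' : Γ' z = Γ z + symMap Υ := by
    ext X v; simp [h, symMap_apply, add_assoc]
  -- The trace of `symMap Υ` is `(n + 1) Υ`, which is the reason for the normalization of
  -- `traceForm`.
  have ht : traceForm Γ' z = traceForm Γ z + Υ := by
    have hn : ((Module.finrank ℝ E : ℝ) + 1) ≠ 0 := by positivity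
    ext X
    simp only [traceForm, h', _root_.smul_apply, ContinuousLinearMap.comp_apply,
      _root_.add_apply, map_add, traceL_symMap, smul_eq_mul]
    field_simp
  ext X v
  simp only [thomas_apply, h, ht, _root_.add_apply, add_smul]
  abel

theorem contDiffAt_traceForm {Γ : E → E →L[ℝ] E →L[ℝ] E} {z : E} (hΓ : ContDiffAt ℝ ∞ Γ z) :
    ContDiffAt ℝ ∞ (traceForm Γ) z :=
  (contDiffAt_const.clm_comp hΓ).const_smul _

theorem contDiffAt_thomas {Γ : E → E →L[ℝ] E →L[ℝ] E} {z : E} (hΓ : ContDiffAt ℝ ∞ Γ z) :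
    ContDiffAt ℝ ∞ (thomas Γ) z := by
  have h1 : ContDiffAt ℝ ∞ (fun z => (traceForm Γ z).smulRight (ContinuousLinearMap.id ℝ E)) z :=
    (contDiffAt_traceForm hΓ).smulRight contDiffAt_const
  exact hΓ.sub (h1.add (contDiffAt_flip h1))

theorem thomas_symm {Γ : E → E →L[ℝ] E →L[ℝ] E} {z : E}
    (hs : ∀ X v, Γ z X v = Γ z v X) (X v : E) : thomas Γ z X v = thomas Γ z v X := by
  rw [thomas_apply, thomas_apply, hs X v]; abel

/-- The contraction `(X, v) ↦ tr (Z ↦ R(Z, X) v)`. -/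
def ricciForm (R : E →L[ℝ] E →L[ℝ] E →L[ℝ] E) : E →L[ℝ] E →L[ℝ] ℝ :=
  (((ContinuousLinearMap.compL ℝ E (E →L[ℝ] E) ℝ) (traceL E)).comp
    ((ContinuousLinearMap.flipₗᵢ ℝ E E E : (E →L[ℝ] E →L[ℝ] E) ≃ₗᵢ[ℝ] _) :
      (E →L[ℝ] E →L[ℝ] E) →L[ℝ] (E →L[ℝ] E →L[ℝ] E))).comp R.flip

theorem ricciForm_apply (R : E →L[ℝ] E →L[ℝ] E →L[ℝ] E) (X v : E) :
    ricciForm R X v = traceL E ((R.flip X).flip v) := rfl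

theorem contDiffAt_ricciForm {R : E → E →L[ℝ] E →L[ℝ] E →L[ℝ] E} {z : E}
    (hR : ContDiffAt ℝ ∞ R z) : ContDiffAt ℝ ∞ (fun z => ricciForm (R z)) z :=
  contDiffAt_const.clm_comp
    (contDiffAt_flip hR)

/-- The trace of the curvature, by the Bianchi identity. -/
theorem traceL_flatCurvature {A : E → E →L[ℝ] E →L[ℝ] E} {z : E} (hA : DifferentiableAt ℝ A z)
    (hs : ∀ᶠ z' in nhds z, ∀ X v, A z' X v = A z' v X) (X v : E) :
    ricciForm (flatCurvature A z) v X - ricciForm (flatCurvature A z) X v =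
      traceL E (flatCurvature A z X v) := by
  have h : flatCurvature A z X v =
      ((flatCurvature A z).flip v).flip X - ((flatCurvature A z).flip X).flip v := by
    ext Z
    have hb := flatCurvature_bianchi hA hs Z X v
    rw [flatCurvature_swap A z v Z X] at hb
    simp only [_root_.sub_apply, ContinuousLinearMap.flip_apply]
    rw [← sub_eq_zero, ← hb]
    abel
  rw [h, map_sub, ricciForm_apply, ricciForm_apply]

/-- The trace commutes with differentiation and vanishes on commutators. -/
theorem traceL_flatCurvature_eq_zero {A : E → E →L[ℝ] E →L[ℝ] E} {z : E}
    (hA : DifferentiableAt ℝ A z) (ht : ∀ z' X, traceL E (A z' X) = 0) (X Y : E) :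
    traceL E (flatCurvature A z X Y) = 0 := by
  have h : ∀ X Y, traceL E (fderiv ℝ A z X Y) = 0 := fun X Y => by
    have h1 := (traceL E).hasFDerivAt.comp z (hA.hasFDerivAt.clm_apply (hasFDerivAt_const Y z))
    have h2 : (fun z' => (traceL E) (A z' Y)) = fun _ => 0 := by ext; simp [ht]
    have h3 := h1.unique (h2 ▸ hasFDerivAt_const (0 : ℝ) z :
      HasFDerivAt (fun z' => (traceL E) (A z' Y)) _ z)
    simpa using congrArg (fun D : E →L[ℝ] ℝ => D X) h3
  have e : flatCurvature A z X Y = fderiv ℝ A z X Y - fderiv ℝ A z Y X +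
      (A z X).comp (A z Y) - (A z Y).comp (A z X) := by
    ext w; simp [flatCurvature_apply]
  rw [e, map_sub, map_add, map_sub, h, h, traceL_comm (A z X)]
  simp

/-- By Bianchi the skew part of the Ricci contraction is a trace of the curvature, and that trace
vanishes for a trace free connection form. -/
theorem ricciForm_thomas_symm {Γ : E → E →L[ℝ] E →L[ℝ] E} {z : E} (hΓ : ContDiffAt ℝ ∞ Γ z)
    (hs : ∀ᶠ z' in nhds z, ∀ X v, Γ z' X v = Γ z' v X) (X v : E) :
    ricciForm (flatCurvature (thomas Γ) z) X v = ricciForm (flatCurvature (thomas Γ) z) v X := by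
  have hd : DifferentiableAt ℝ (thomas Γ) z := (contDiffAt_thomas hΓ).differentiableAt (by simp)
  have := traceL_flatCurvature hd (hs.mono fun z' h => thomas_symm h) X v
  rw [traceL_flatCurvature_eq_zero hd (traceL_thomas Γ)] at this
  linarith

/-- The form `K(X, v) = (∇_X θ)(v) + θ(X) θ(v)`, which relates the curvature of `Γ` to the
curvature of its Thomas symbols. -/
def thetaForm (Γ : E → E →L[ℝ] E →L[ℝ] E) (z : E) : E →L[ℝ] E →L[ℝ] ℝ :=
  fderiv ℝ (traceForm Γ) z - ((ContinuousLinearMap.compL ℝ E E ℝ) (traceForm Γ z)).comp (thomas Γ z)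
    - (traceForm Γ z).smulRight (traceForm Γ z)

theorem thetaForm_apply (Γ : E → E →L[ℝ] E →L[ℝ] E) (z X v : E) :
    thetaForm Γ z X v = fderiv ℝ (traceForm Γ) z X v - traceForm Γ z (thomas Γ z X v) -
      traceForm Γ z X * traceForm Γ z v := by
  simp [thetaForm]

/-- Obtained by inserting `Γ = Π + symMap θ`. The multiple of the identity comes from the skew part
of `thetaForm`, and only symmetry of that form removes it. -/
theorem flatCurvature_eq_thomas {Γ : E → E →L[ℝ] E →L[ℝ] E} {z : E} (hΓ : ContDiffAt ℝ ∞ Γ z)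
    (hs : ∀ᶠ z' in nhds z, ∀ X v, Γ z' X v = Γ z' v X) (X Y v : E) :
    flatCurvature Γ z X Y v = flatCurvature (thomas Γ) z X Y v +
      thetaForm Γ z X v • Y - thetaForm Γ z Y v • X +
      (thetaForm Γ z X Y - thetaForm Γ z Y X) • v := by
  have hB : DifferentiableAt ℝ (thomas Γ) z := (contDiffAt_thomas hΓ).differentiableAt (by simp)
  have hθ : DifferentiableAt ℝ (traceForm Γ) z :=
    (contDiffAt_traceForm hΓ).differentiableAt (by simp)
  have hD : ∀ X Y, fderiv ℝ Γ z X Y v = fderiv ℝ (thomas Γ) z X Y v +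
      fderiv ℝ (traceForm Γ) z X Y • v + fderiv ℝ (traceForm Γ) z X v • Y := by
    intro X Y
    have h1 := ((hB.hasFDerivAt.clm_apply (hasFDerivAt_const Y z)).clm_apply
      (hasFDerivAt_const v z)).add
      ((((hθ.hasFDerivAt.clm_apply (hasFDerivAt_const Y z)).smul (hasFDerivAt_const v z)).add
      ((hθ.hasFDerivAt.clm_apply (hasFDerivAt_const v z)).smul (hasFDerivAt_const Y z))))
    rw [fderiv_clm_apply_const (hΓ.differentiableAt (by simp))]
    have h2 := (h1.congr_of_eventuallyEq (f₁ := fun z' => Γ z' Y v)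
      (Filter.Eventually.of_forall fun z' => by
        simp only [Pi.add_apply, Pi.smul_apply']
        rw [eq_thomas_add Γ z' Y v, add_assoc])).fderiv
    rw [h2]
    simp [add_assoc]
  have hsB := thomas_symm hs.self_of_nhds X Y
  simp only [flatCurvature_apply, hD, thetaForm_apply]
  rw [eq_thomas_add Γ z Y v, eq_thomas_add Γ z X v]
  simp only [map_add, map_smul, eq_thomas_add Γ z, hsB]
  module

/-- The projective Schouten tensor in terms of the curvature. -/
def schoutenForm (R : E →L[ℝ] E →L[ℝ] E →L[ℝ] E) (X v : E) : ℝ :=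
  (Module.finrank ℝ E * ricciForm R X v + ricciForm R v X) / ((Module.finrank ℝ E : ℝ) ^ 2 - 1)

/-- The bilinear form `Q = P + K` in the tractor connection. -/
def rhoForm (Γ : E → E →L[ℝ] E →L[ℝ] E) (z : E) : E →L[ℝ] E →L[ℝ] ℝ :=
  ((Module.finrank ℝ E : ℝ) - 1)⁻¹ • ricciForm (flatCurvature (thomas Γ) z)

theorem rhoForm_symm {Γ : E → E →L[ℝ] E →L[ℝ] E} {z : E} (hΓ : ContDiffAt ℝ ∞ Γ z)
    (hs : ∀ᶠ z' in nhds z, ∀ X v, Γ z' X v = Γ z' v X) (X v : E) :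
    rhoForm Γ z X v = rhoForm Γ z v X := by
  simp [rhoForm, ricciForm_thomas_symm hΓ hs X v]

theorem contDiffAt_rhoForm {Γ : E → E →L[ℝ] E →L[ℝ] E} {z : E} (hΓ : ContDiffAt ℝ ∞ Γ z) :
    ContDiffAt ℝ ∞ (rhoForm Γ) z :=
  (contDiffAt_ricciForm (contDiffAt_flatCurvature (contDiffAt_thomas hΓ))).const_smul _

theorem ricciForm_flatCurvature {Γ : E → E →L[ℝ] E →L[ℝ] E} {z : E} (hΓ : ContDiffAt ℝ ∞ Γ z)
    (hs : ∀ᶠ z' in nhds z, ∀ X v, Γ z' X v = Γ z' v X) (X v : E) :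
    ricciForm (flatCurvature Γ z) X v = ricciForm (flatCurvature (thomas Γ) z) X v -
      Module.finrank ℝ E * thetaForm Γ z X v + thetaForm Γ z v X := by
  have e : ((flatCurvature Γ z).flip X).flip v = ((flatCurvature (thomas Γ) z).flip X).flip v +
      ((thetaForm Γ z).flip v).smulRight X - thetaForm Γ z X v • ContinuousLinearMap.id ℝ E +
      ((thetaForm Γ z).flip X).smulRight v - (thetaForm Γ z X).smulRight v := by
    ext Z
    simp only [ContinuousLinearMap.flip_apply, flatCurvature_eq_thomas hΓ hs Z X v,
      _root_.add_apply, _root_.sub_apply,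
      ContinuousLinearMap.smulRight_apply, _root_.smul_apply,
      ContinuousLinearMap.id_apply, sub_smul]
    abel
  rw [ricciForm_apply, e, map_sub, map_add, map_sub, map_add, map_smul, traceL_id,
    traceL_smulRight, traceL_smulRight, traceL_smulRight, ricciForm_apply]
  simp only [ContinuousLinearMap.flip_apply, smul_eq_mul]
  ring

/-- The combination `n Ric(X, v) + Ric(v, X)` turns the `K` terms of the Ricci tensor into `(1 - n²)
K(X, v)`, and the symmetric part from `thomas Γ` acquires the factor `n + 1`. As `rhoForm` is
symmetric, the Schouten tensor is symmetric exactly when `thetaForm` is. -/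
theorem schoutenForm_eq (hn : 2 ≤ Module.finrank ℝ E) {Γ : E → E →L[ℝ] E →L[ℝ] E} {z : E}
    (hΓ : ContDiffAt ℝ ∞ Γ z) (hs : ∀ᶠ z' in nhds z, ∀ X v, Γ z' X v = Γ z' v X) (X v : E) :
    schoutenForm (flatCurvature Γ z) X v = rhoForm Γ z X v - thetaForm Γ z X v := by
  have h : (2 : ℝ) ≤ Module.finrank ℝ E := by exact_mod_cast hn
  have h1 : ((Module.finrank ℝ E : ℝ) ^ 2 - 1) ≠ 0 := by nlinarith
  have h2 : ((Module.finrank ℝ E : ℝ) - 1) ≠ 0 := by linarith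
  simp only [schoutenForm, rhoForm, ricciForm_flatCurvature hΓ hs, _root_.smul_apply,
    smul_eq_mul, ricciForm_thomas_symm hΓ hs v X]
  field_simp
  ring

/-- The connection form of the tractor connection. -/
def tractorForm (Γ : E → E →L[ℝ] E →L[ℝ] E) (z : E) : E →L[ℝ] (E × ℝ) →L[ℝ] (E × ℝ) :=
  ((ContinuousLinearMap.compL ℝ (E × ℝ) E (E × ℝ) (ContinuousLinearMap.inl ℝ E ℝ)).comp
    ((ContinuousLinearMap.compL ℝ (E × ℝ) E E).flip (ContinuousLinearMap.fst ℝ E ℝ))).comp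
      (thomas Γ z) +
  (ContinuousLinearMap.compL ℝ (E × ℝ) E (E × ℝ) (ContinuousLinearMap.inl ℝ E ℝ)).comp
    (ContinuousLinearMap.smulRightL ℝ (E × ℝ) E (ContinuousLinearMap.snd ℝ E ℝ)) -
  ((ContinuousLinearMap.compL ℝ (E × ℝ) ℝ (E × ℝ) (ContinuousLinearMap.inr ℝ E ℝ)).comp
    ((ContinuousLinearMap.compL ℝ (E × ℝ) E ℝ).flip (ContinuousLinearMap.fst ℝ E ℝ))).comp
      (rhoForm Γ z)

theorem tractorForm_apply (Γ : E → E →L[ℝ] E →L[ℝ] E) (z X : E) (w : E × ℝ) :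
    tractorForm Γ z X w = (thomas Γ z X w.1 + w.2 • X, -rhoForm Γ z X w.1) := by
  ext <;> simp [tractorForm]

theorem contDiffAt_tractorForm {Γ : E → E →L[ℝ] E →L[ℝ] E} {z : E} (hΓ : ContDiffAt ℝ ∞ Γ z) :
    ContDiffAt ℝ ∞ (tractorForm Γ) z :=
  ((contDiffAt_const.clm_comp (contDiffAt_thomas hΓ)).add contDiffAt_const).sub
    (contDiffAt_const.clm_comp (contDiffAt_rhoForm hΓ))

/-- This is the projective invariance of the tractor connection. Equality near `z` is needed because
`rhoForm` contains first derivatives of the Thomas symbols. -/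
theorem tractorForm_congr {Γ Γ' : E → E →L[ℝ] E →L[ℝ] E} {z : E}
    (h : thomas Γ =ᶠ[nhds z] thomas Γ') : tractorForm Γ z = tractorForm Γ' z := by
  simp only [tractorForm, rhoForm, flatCurvature_congr h, h.eq_of_nhds]

/-- On `(0, 1)` the curvature is `(Π(X, Y) - Π(Y, X), Q(Y, X) - Q(X, Y))`, which vanishes by the
symmetry of `Π` and `Q`. The lower left entry, a Cotton type tensor, is not needed because it does
not contribute to the traces. -/
theorem flatCurvature_tractorForm {Γ : E → E →L[ℝ] E →L[ℝ] E} {z : E} (hΓ : ContDiffAt ℝ ∞ Γ z)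
    (hs : ∀ᶠ z' in nhds z, ∀ X v, Γ z' X v = Γ z' v X) (X Y : E) (w : E × ℝ) :
    (flatCurvature (tractorForm Γ) z X Y w).1 = flatCurvature (thomas Γ) z X Y w.1 +
      rhoForm Γ z X w.1 • Y - rhoForm Γ z Y w.1 • X ∧
    (flatCurvature (tractorForm Γ) z X Y (0, 1)) = 0 := by
  have hB : DifferentiableAt ℝ (thomas Γ) z := (contDiffAt_thomas hΓ).differentiableAt (by simp)
  have hQ : DifferentiableAt ℝ (rhoForm Γ) z := (contDiffAt_rhoForm hΓ).differentiableAt (by simp)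
  have hA : DifferentiableAt ℝ (tractorForm Γ) z :=
    (contDiffAt_tractorForm hΓ).differentiableAt (by simp)
  have hD : ∀ X Y w, fderiv ℝ (tractorForm Γ) z X Y w =
      (fderiv ℝ (thomas Γ) z X Y w.1, -fderiv ℝ (rhoForm Γ) z X Y w.1) := by
    intro X Y w
    rw [fderiv_clm_apply_const hA]
    have h1 := (((hB.hasFDerivAt.clm_apply (hasFDerivAt_const Y z)).clm_apply
      (hasFDerivAt_const w.1 z)).add (hasFDerivAt_const (w.2 • Y) z)).prodMk
      ((hQ.hasFDerivAt.clm_apply (hasFDerivAt_const Y z)).clm_apply (hasFDerivAt_const w.1 z)).neg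
    have h2 := (h1.congr_of_eventuallyEq (f₁ := fun z' => tractorForm Γ z' Y w)
      (Filter.Eventually.of_forall fun z' => by
        simp [tractorForm_apply])).fderiv
    rw [h2]
    simp
  have hsB := thomas_symm hs.self_of_nhds
  have hsQ := rhoForm_symm hΓ hs
  constructor
  · simp only [flatCurvature_apply, hD, tractorForm_apply, Prod.fst_add, Prod.fst_sub, map_add,
      map_smul, hsB X Y, neg_smul]
    abel
  · simp only [flatCurvature_apply, hD, tractorForm_apply, map_zero, neg_zero, one_smul, zero_add,
      zero_smul, add_zero, hsB X Y, hsQ X Y, sub_self, Prod.mk_zero_zero]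

end Flat

end ProjectiveTractor

end

noncomputable section

namespace ProjectiveTractor

/-! ### Sections, Lie brackets and curvature read in a chart -/

section Charts

variable {n : ℕ} {M : Type*} [TopologicalSpace M]
  [ChartedSpace (EuclideanSpace ℝ (Fin n)) M] [IsManifold (𝓡 n) ∞ M]
  {G : Type*} [NormedAddCommGroup G] [NormedSpace ℝ G]

local notation "𝔼" => EuclideanSpace ℝ (Fin n)

/-- The coordinates in the chart `i` of a tangent vector at `y`. -/
def chartVec (i : atlas 𝔼 M) (y : M) (X : TangentSpace (𝓡 n) y) : 𝔼 :=
  tangentChange (achart 𝔼 y) i y X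

/-- The representative in the chart `i` of a section of a vector bundle core over the atlas. -/
def coreCoord (Z : VectorBundleCore ℝ M G (atlas 𝔼 M)) (i : atlas 𝔼 M) (s : Π y, Z.Fiber y)
    (z : 𝔼) : G :=
  Z.coordChange (Z.indexAt (i.1.symm z)) i (i.1.symm z) (s (i.1.symm z))

/-- The representative in the chart `i` of a vector field. -/
def vectorCoord (i : atlas 𝔼 M) (s : Π y : M, TangentSpace (𝓡 n) y) (z : 𝔼) : 𝔼 :=
  chartVec i (i.1.symm z) (s (i.1.symm z))

omit [IsManifold (𝓡 n) ∞ M] in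
theorem coreCoord_chart (Z : VectorBundleCore ℝ M G (atlas 𝔼 M)) (i : atlas 𝔼 M)
    (s : Π y, Z.Fiber y) {y : M} (hy : y ∈ i.1.source) :
    coreCoord Z i s (i.1 y) = Z.coordChange (Z.indexAt y) i y (s y) := by
  rw [coreCoord, i.1.left_inv hy]

theorem vectorCoord_chart (i : atlas 𝔼 M) (s : Π y : M, TangentSpace (𝓡 n) y) {y : M}
    (hy : y ∈ i.1.source) : vectorCoord i s (i.1 y) = chartVec i y (s y) :=
  coreCoord_chart (tangentBundleCore (𝓡 n) M) i s hy

omit [IsManifold (𝓡 n) ∞ M] in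
theorem extend_core (Z : VectorBundleCore ℝ M G (atlas 𝔼 M)) {x y : M}
    (hy : y ∈ Z.baseSet (Z.indexAt x)) (w : Z.Fiber x) :
    (FiberBundle.extend G w : Π y, Z.Fiber y) y = Z.coordChange (Z.indexAt x) (Z.indexAt y) y w := by
  change (Z.localTriv (Z.indexAt x)).symm y _ = _
  rw [Z.localTriv_symm_apply _ hy]
  have : (trivializationAt G Z.Fiber x ⟨x, w⟩).2 = w :=
    Z.coordChange_self _ x (Z.mem_baseSet_at x) w
  rw [this]

theorem mdifferentiableAt_iff_chart (i : atlas 𝔼 M) (f : M → G) {y : M} (hy : y ∈ i.1.source) :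
    MDifferentiableAt (𝓡 n) 𝓘(ℝ, G) f y ↔
      DifferentiableAt ℝ (fun z => f (i.1.symm z)) (i.1 y) := by
  have hi := IsManifold.subset_maximalAtlas (I := 𝓡 n) (n := 1) i.2
  constructor
  · intro h
    have h1 := ((contMDiffOn_symm_of_mem_maximalAtlas hi).contMDiffAt
      (i.1.open_target.mem_nhds (i.1.map_source hy))).mdifferentiableAt one_ne_zero
    rw [← i.1.left_inv hy] at h
    exact (h.comp (i.1 y) h1).differentiableAt
  · intro h
    have h1 := ((contMDiffOn_of_mem_maximalAtlas hi).contMDiffAt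
      (i.1.open_source.mem_nhds hy)).mdifferentiableAt one_ne_zero
    refine (h.mdifferentiableAt.comp y h1).congr_of_eventuallyEq ?_
    filter_upwards [i.1.open_source.mem_nhds hy] with y' hy'
    simp [i.1.left_inv hy']

theorem mdifferentiableAt_section_iff_core (Z : VectorBundleCore ℝ M G (atlas 𝔼 M))
    (s : Π y, Z.Fiber y) {x : M} (hi : Z.indexAt x = achart 𝔼 x) :
    MDifferentiableAt (𝓡 n) ((𝓡 n).prod 𝓘(ℝ, G))
      (fun y => (⟨y, s y⟩ : Bundle.TotalSpace G Z.Fiber)) x ↔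
      DifferentiableAt ℝ (coreCoord Z (achart 𝔼 x) s) (chartAt 𝔼 x x) := by
  rw [mdifferentiableAt_section]
  change MDifferentiableAt (𝓡 n) 𝓘(ℝ, G)
    (fun y => Z.coordChange (Z.indexAt y) (Z.indexAt x) y (s y)) x ↔ _
  rw [mdifferentiableAt_iff_chart (achart 𝔼 x) _ (mem_chart_source 𝔼 x), hi]
  rfl

theorem mdifferentiableAt_vectorField_iff (i : atlas 𝔼 M) (s : Π y : M, TangentSpace (𝓡 n) y)
    {y : M} (hy : y ∈ i.1.source) :
    MDifferentiableAt (𝓡 n) (𝓡 n).tangent (fun y => (⟨y, s y⟩ : TangentBundle (𝓡 n) M)) y ↔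
      DifferentiableAt ℝ (vectorCoord i s) (i.1 y) := by
  have : ContMDiffVectorBundle 1 𝔼 (tangentBundleCore (𝓡 n) M).Fiber (𝓡 n) :=
    (inferInstance : ContMDiffVectorBundle 1 𝔼 (TangentSpace (𝓡 n) : M → Type _) (𝓡 n))
  have : MemTrivializationAtlas ((tangentBundleCore (𝓡 n) M).localTriv i) := ⟨⟨i, rfl⟩⟩
  have h := Bundle.Trivialization.mdifferentiableAt_section_iff (𝓡 n)
    ((tangentBundleCore (𝓡 n) M).localTriv i) (E := (tangentBundleCore (𝓡 n) M).Fiber) s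
    (b₀ := y) hy
  exact h.trans (mdifferentiableAt_iff_chart i
    (fun y => (tangentBundleCore (𝓡 n) M).coordChange (achart 𝔼 y) i y (s y)) hy)

/-- Tangent vectors at a point are coordinatized by the preferred chart at that point, so the
derivative of the inverse chart is a transition map and not the identity. -/
theorem hasMFDerivAt_chart_symm (i : atlas 𝔼 M) {z : 𝔼} (hz : z ∈ i.1.target) :
    HasMFDerivAt 𝓘(ℝ, 𝔼) (𝓡 n) i.1.symm z
      (tangentChange i (achart 𝔼 (i.1.symm z)) (i.1.symm z)) := by
  refine ⟨i.1.continuousAt_symm hz, ?_⟩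
  have h := hasFDerivAt_trans i (achart 𝔼 (i.1.symm z))
    ⟨i.1.map_target hz, mem_chart_source 𝔼 (i.1.symm z)⟩
  rw [i.1.right_inv hz] at h
  exact h.hasFDerivWithinAt

theorem tangentChange_apply_self (i : atlas 𝔼 M) {x : M} (hx : x ∈ i.1.source) (v : 𝔼) :
    tangentChange i i x v = v := by
  simp [tangentChange_self i hx]

theorem tangentChange_tangentChange (i j k : atlas 𝔼 M) {x : M} (hi : x ∈ i.1.source)
    (hj : x ∈ j.1.source) (hk : x ∈ k.1.source) (v : 𝔼) :
    tangentChange j k x (tangentChange i j x v) = tangentChange i k x v := by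
  rw [← tangentChange_comp i j k ⟨⟨hi, hj⟩, hk⟩]; rfl

theorem vectorCoord_eq_mpullback (i : atlas 𝔼 M) (V : Π y : M, TangentSpace (𝓡 n) y) {z : 𝔼}
    (hz : z ∈ i.1.target) :
    VectorField.mpullback 𝓘(ℝ, 𝔼) (𝓡 n) i.1.symm V z = vectorCoord i V z := by
  have hs := i.1.map_target hz
  have hc := mem_chart_source 𝔼 (i.1.symm z)
  rw [VectorField.mpullback_apply, (hasMFDerivAt_chart_symm i hz).mfderiv]
  have h : (tangentChange i (achart 𝔼 (i.1.symm z)) (i.1.symm z)).inverse =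
      tangentChange (achart 𝔼 (i.1.symm z)) i (i.1.symm z) := by
    refine ContinuousLinearMap.inverse_eq ?_ ?_
    · rw [tangentChange_comp _ _ _ ⟨⟨hc, hs⟩, hc⟩, tangentChange_self _ hc]
    · rw [tangentChange_comp _ _ _ ⟨⟨hs, hc⟩, hs⟩, tangentChange_self _ hs]
  exact congrArg (fun L : 𝔼 →L[ℝ] 𝔼 => L (V (i.1.symm z))) h

/-- The Lie bracket of vector fields in a chart. -/
theorem vectorCoord_mlieBracket (i : atlas 𝔼 M) {V W : Π y : M, TangentSpace (𝓡 n) y} {y : M}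
    (hy : y ∈ i.1.source)
    (hV : MDifferentiableAt (𝓡 n) (𝓡 n).tangent
      (fun y => (⟨y, V y⟩ : TangentBundle (𝓡 n) M)) y)
    (hW : MDifferentiableAt (𝓡 n) (𝓡 n).tangent
      (fun y => (⟨y, W y⟩ : TangentBundle (𝓡 n) M)) y) :
    chartVec i y (VectorField.mlieBracket (𝓡 n) V W y) =
      VectorField.lieBracket ℝ (vectorCoord i V) (vectorCoord i W) (i.1 y) := by
  have hz := i.1.map_source hy
  have hy' := i.1.left_inv hy
  have hi := IsManifold.subset_maximalAtlas (I := 𝓡 n) (n := 2) i.2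
  have h1 : ContMDiffAt 𝓘(ℝ, 𝔼) (𝓡 n) 2 i.1.symm (i.1 y) :=
    (contMDiffOn_symm_of_mem_maximalAtlas hi).contMDiffAt (i.1.open_target.mem_nhds hz)
  have : IsManifold (𝓡 n) (minSmoothness ℝ 2) M := by
    rw [minSmoothness_of_isRCLikeNormedField]; infer_instance
  have h2 := VectorField.mpullback_mlieBracket (V := V) (W := W) (x₀ := i.1 y)
    (by rwa [hy']) (by rwa [hy']) h1 (by simp)
  rw [vectorCoord_eq_mpullback i _ hz, vectorCoord_chart i _ hy] at h2
  have hev : ∀ V : Π y : M, TangentSpace (𝓡 n) y,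
      VectorField.mpullback 𝓘(ℝ, 𝔼) (𝓡 n) i.1.symm V =ᶠ[nhds (i.1 y)] vectorCoord i V := fun V => by
    filter_upwards [i.1.open_target.mem_nhds hz] with z hz using vectorCoord_eq_mpullback i V hz
  have h3 : ∀ V W : 𝔼 → 𝔼, VectorField.mlieBracket 𝓘(ℝ, 𝔼) V W (i.1 y) =
      VectorField.lieBracket ℝ V W (i.1 y) := fun V W =>
    (congrFun (VectorField.mlieBracketWithin_eq_lieBracketWithin (𝕜 := ℝ) (E := 𝔼) (V := V)
      (W := W) (s := Set.univ)) (i.1 y)).trans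
      (congrFun (VectorField.lieBracketWithin_univ (𝕜 := ℝ) (E := 𝔼) (V := V) (W := W)) _)
  exact h2.trans ((h3 _ _).trans
    (Filter.EventuallyEq.lieBracket_vectorField_eq (𝕜 := ℝ) (E := 𝔼) (hev V) (hev W)))

/-- The operator `D` on sections is given in the chart `i` by `d + A`. -/
def HasConnectionForm (Z : VectorBundleCore ℝ M G (atlas 𝔼 M))
    (D : (Π y, Z.Fiber y) → Π y : M, TangentSpace (𝓡 n) y → Z.Fiber y) (i : atlas 𝔼 M)
    (A : 𝔼 → 𝔼 →L[ℝ] G →L[ℝ] G) : Prop :=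
  ∀ s : Π y, Z.Fiber y, ∀ y ∈ i.1.source, DifferentiableAt ℝ (coreCoord Z i s) (i.1 y) →
    ∀ X : TangentSpace (𝓡 n) y, Z.coordChange (Z.indexAt y) i y (D s y X) =
      fderiv ℝ (coreCoord Z i s) (i.1 y) (chartVec i y X) +
        A (i.1 y) (chartVec i y X) (coreCoord Z i s (i.1 y))

/-- The extension has constant coordinates in the preferred chart at `x`; another chart sees the
transition map applied to them. -/
theorem vectorCoord_extend (i : atlas 𝔼 M) {x : M} (hx : x ∈ i.1.source)
    (u : TangentSpace (𝓡 n) x) : vectorCoord i (FiberBundle.extend 𝔼 u) =ᶠ[nhds (i.1 x)]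
      fun z => tangentChange (achart 𝔼 x) i (i.1.symm z) u := by
  have hU : i.1.symm ⁻¹' (chartAt 𝔼 x).source ∈ nhds (i.1 x) := by
    refine (i.1.continuousAt_symm (i.1.map_source hx)).preimage_mem_nhds ?_
    rw [i.1.left_inv hx]
    exact (chartAt 𝔼 x).open_source.mem_nhds (mem_chart_source 𝔼 x)
  filter_upwards [i.1.open_target.mem_nhds (i.1.map_source hx), hU] with z hz hz'
  have h := extend_core (tangentBundleCore (𝓡 n) M) (x := x) (y := i.1.symm z) hz' u
  have h' : vectorCoord i (FiberBundle.extend 𝔼 u) z =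
      tangentChange (achart 𝔼 (i.1.symm z)) i (i.1.symm z)
        (tangentChange (achart 𝔼 x) (achart 𝔼 (i.1.symm z)) (i.1.symm z) u) :=
    congrArg (tangentChange (achart 𝔼 (i.1.symm z)) i (i.1.symm z)) h
  exact h'.trans (tangentChange_tangentChange _ _ _ hz' (mem_chart_source 𝔼 _) (i.1.map_target hz) _)

theorem contDiffAt_tangentChange (i j : atlas 𝔼 M) {x : M} (hi : x ∈ i.1.source)
    (hj : x ∈ j.1.source) :
    ContDiffAt ℝ ∞ (fun z => tangentChange i j (i.1.symm z)) (i.1 x) :=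
  (contDiffOn_tangentChange i j).contDiffAt
    ((i.1.symm ≫ₕ j.1).open_source.mem_nhds (mem_overlap' i j ⟨hi, hj⟩))

theorem contDiffAt_transition (i j : atlas 𝔼 M) {x : M} (hi : x ∈ i.1.source)
    (hj : x ∈ j.1.source) : ContDiffAt ℝ ∞ (fun z => j.1 (i.1.symm z)) (i.1 x) := by
  have h1 := (contMDiffOn_symm_of_mem_maximalAtlas (I := 𝓡 n) (n := ∞)
    (IsManifold.subset_maximalAtlas i.2)).contMDiffAt
    (i.1.open_target.mem_nhds (i.1.map_source hi))
  have h2 := (contMDiffOn_of_mem_maximalAtlas (I := 𝓡 n) (n := ∞)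
    (IsManifold.subset_maximalAtlas j.2)).contMDiffAt (j.1.open_source.mem_nhds hj)
  rw [← i.1.left_inv hi] at h2
  exact (h2.comp (i.1 x) h1).contDiffAt

theorem contDiffAt_tangentChange' (i j : atlas 𝔼 M) {x : M} (hi : x ∈ i.1.source)
    (hj : x ∈ j.1.source) :
    ContDiffAt ℝ ∞ (fun z => tangentChange j i (i.1.symm z)) (i.1 x) := by
  have h1 := contDiffAt_tangentChange j i hj hi
  have h2 := contDiffAt_transition i j hi hj
  rw [show j.1 x = j.1 (i.1.symm (i.1 x)) by rw [i.1.left_inv hi]] at h1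
  refine (h1.comp (i.1 x) h2).congr_of_eventuallyEq ?_
  filter_upwards [(i.1.symm ≫ₕ j.1).open_source.mem_nhds (mem_overlap' i j ⟨hi, hj⟩)] with z hz
  simp [j.1.left_inv (mem_overlap i j hz).2]

/-- The curvature of a connection in a chart. -/
theorem coordChange_curvature (Z : VectorBundleCore ℝ M G (atlas 𝔼 M))
    (D : (Π y, Z.Fiber y) → Π y : M, TangentSpace (𝓡 n) y → Z.Fiber y) (i : atlas 𝔼 M)
    (A : 𝔼 → 𝔼 →L[ℝ] G →L[ℝ] G) (hD : HasConnectionForm Z D i A) {x : M} (hx : x ∈ i.1.source)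
    (hA : DifferentiableAt ℝ A (i.1 x)) (u v : TangentSpace (𝓡 n) x) (w : Z.Fiber x)
    (hw : ContDiffAt ℝ ∞ (coreCoord Z i (FiberBundle.extend G w)) (i.1 x)) :
    Z.coordChange (Z.indexAt x) i x (curvature G D x u v w) =
      flatCurvature A (i.1 x) (chartVec i x u) (chartVec i x v)
        (Z.coordChange (Z.indexAt x) i x w) := by
  set s : Π y, Z.Fiber y := FiberBundle.extend G w with hs
  have hsx : s x = w := FiberBundle.extend_apply_self _ _
  have hsc : coreCoord Z i s (i.1 x) = Z.coordChange (Z.indexAt x) i x w := by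
    rw [coreCoord_chart Z i s hx, hsx]
  have hdiff : ∀ᶠ z in nhds (i.1 x), DifferentiableAt ℝ (coreCoord Z i s) z := by
    have := (hw.of_le (m := 1) (by simp)).eventually (by simp)
    exact this.mono fun z hz => hz.differentiableAt (by simp)
  have hX : ∀ u : TangentSpace (𝓡 n) x,
      DifferentiableAt ℝ (vectorCoord i (FiberBundle.extend 𝔼 u)) (i.1 x) := fun u => by
    refine DifferentiableAt.congr_of_eventuallyEq ?_ (vectorCoord_extend i hx u)
    exact ((contDiffAt_tangentChange' i (achart 𝔼 x) hx
      (mem_chart_source 𝔼 x)).differentiableAt (by simp)).clm_apply (differentiableAt_const _)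
  have hXx : ∀ u : TangentSpace (𝓡 n) x,
      vectorCoord i (FiberBundle.extend 𝔼 u) (i.1 x) = chartVec i x u := fun u => by
    rw [vectorCoord_chart i _ hx, FiberBundle.extend_apply_self]
  have hXm : ∀ u : TangentSpace (𝓡 n) x, MDifferentiableAt (𝓡 n) (𝓡 n).tangent
      (fun y => (⟨y, FiberBundle.extend 𝔼 u y⟩ : TangentBundle (𝓡 n) M)) x := fun u =>
    (mdifferentiableAt_vectorField_iff i _ hx).2 (hX u)
  have hcoord : ∀ v : TangentSpace (𝓡 n) x,
      coreCoord Z i (fun y => D s y (FiberBundle.extend 𝔼 v y)) =ᶠ[nhds (i.1 x)] fun z =>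
        fderiv ℝ (coreCoord Z i s) z (vectorCoord i (FiberBundle.extend 𝔼 v) z) +
          A z (vectorCoord i (FiberBundle.extend 𝔼 v) z) (coreCoord Z i s z) := fun v => by
    filter_upwards [i.1.open_target.mem_nhds (i.1.map_source hx), hdiff] with z hz hz'
    have h := hD s (i.1.symm z) (i.1.map_target hz)
    rw [i.1.right_inv hz] at h
    exact h hz' _
  have hd1 : HasFDerivAt (coreCoord Z i s) (fderiv ℝ (coreCoord Z i s) (i.1 x)) (i.1 x) :=
    hdiff.self_of_nhds.hasFDerivAt
  have hd2 : DifferentiableAt ℝ (fderiv ℝ (coreCoord Z i s)) (i.1 x) :=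
    (hw.fderiv_right (m := ∞) (by simp)).differentiableAt (by simp)
  -- The second derivatives of the section cancel between the two iterated covariant derivatives.
  have hsymm : ∀ a b, fderiv ℝ (fderiv ℝ (coreCoord Z i s)) (i.1 x) a b =
      fderiv ℝ (fderiv ℝ (coreCoord Z i s)) (i.1 x) b a := fun a b =>
    ((hw.of_le (m := 2) (WithTop.coe_le_coe.2 (le_top : (2 : ℕ∞) ≤ ⊤))).isSymmSndFDerivAt (by simp)).eq a b
  have hder : ∀ v, HasFDerivAt (coreCoord Z i (fun y => D s y (FiberBundle.extend 𝔼 v y))) _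
      (i.1 x) := fun v =>
    ((hd2.hasFDerivAt.clm_apply (hX v).hasFDerivAt).add
      ((hA.hasFDerivAt.clm_apply (hX v).hasFDerivAt).clm_apply hd1)).congr_of_eventuallyEq
        (hcoord v)
  have key : ∀ u v : TangentSpace (𝓡 n) x,
      Z.coordChange (Z.indexAt x) i x (D (fun y => D s y (FiberBundle.extend 𝔼 v y)) x u) =
      fderiv ℝ (fderiv ℝ (coreCoord Z i s)) (i.1 x) (chartVec i x u) (chartVec i x v) +
      fderiv ℝ (coreCoord Z i s) (i.1 x)
        (fderiv ℝ (vectorCoord i (FiberBundle.extend 𝔼 v)) (i.1 x) (chartVec i x u)) +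
      fderiv ℝ A (i.1 x) (chartVec i x u) (chartVec i x v) (coreCoord Z i s (i.1 x)) +
      A (i.1 x) (fderiv ℝ (vectorCoord i (FiberBundle.extend 𝔼 v)) (i.1 x) (chartVec i x u))
        (coreCoord Z i s (i.1 x)) +
      A (i.1 x) (chartVec i x v) (fderiv ℝ (coreCoord Z i s) (i.1 x) (chartVec i x u)) +
      A (i.1 x) (chartVec i x u) (fderiv ℝ (coreCoord Z i s) (i.1 x) (chartVec i x v)) +
      A (i.1 x) (chartVec i x u) (A (i.1 x) (chartVec i x v) (coreCoord Z i s (i.1 x))) :=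
    fun u v => by
    rw [hD _ x hx (hder v).differentiableAt u, (hder v).fderiv, (hcoord v).self_of_nhds, hXx]
    simp only [add_apply, ContinuousLinearMap.comp_apply, ContinuousLinearMap.flip_apply, map_add,
      hXx]
    abel
  -- The extended fields need not be constant in the chart `i`. The derivatives of their coordinates
  -- that appear in `key` are exactly what the bracket term removes.
  have hbr : chartVec i x (VectorField.mlieBracket (𝓡 n) (FiberBundle.extend 𝔼 u)
      (FiberBundle.extend 𝔼 v) x) =
      fderiv ℝ (vectorCoord i (FiberBundle.extend 𝔼 v)) (i.1 x) (chartVec i x u) -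
        fderiv ℝ (vectorCoord i (FiberBundle.extend 𝔼 u)) (i.1 x) (chartVec i x v) := by
    rw [vectorCoord_mlieBracket i hx (hXm u) (hXm v), VectorField.lieBracket, hXx, hXx]
  have h3 := hD s x hx hdiff.self_of_nhds (VectorField.mlieBracket (𝓡 n)
    (FiberBundle.extend 𝔼 u) (FiberBundle.extend 𝔼 v) x)
  rw [hbr] at h3
  have hsub : ∀ a b c : Z.Fiber x, Z.coordChange (Z.indexAt x) i x (a - b - c) =
      Z.coordChange (Z.indexAt x) i x a - Z.coordChange (Z.indexAt x) i x b -
        Z.coordChange (Z.indexAt x) i x c := fun a b c =>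
    ((Z.coordChange (Z.indexAt x) i x).map_sub (a - b) c).trans
      (congrArg (· - _) ((Z.coordChange (Z.indexAt x) i x).map_sub a b))
  unfold curvature
  simp only []
  rw [hsub, key, key, h3, flatCurvature_apply, hsymm (chartVec i x v), hsc]
  simp only [map_sub, sub_apply]
  abel

end Charts
end ProjectiveTractor
end

noncomputable section

namespace ProjectiveTractor

/-! ### Christoffel symbols of an affine connection and their smoothness -/

section Christoffel

variable {n : ℕ} {M : Type*} [TopologicalSpace M]
  [ChartedSpace (EuclideanSpace ℝ (Fin n)) M] [IsManifold (𝓡 n) ∞ M]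
  {G : Type*} [NormedAddCommGroup G] [NormedSpace ℝ G]

local notation "𝔼" => EuclideanSpace ℝ (Fin n)

theorem chartVec_add (i : atlas 𝔼 M) (y : M) (X Y : TangentSpace (𝓡 n) y) :
    chartVec i y (X + Y) = chartVec i y X + chartVec i y Y :=
  (tangentChange (achart 𝔼 y) i y).map_add X Y

theorem chartVec_smul (i : atlas 𝔼 M) (y : M) (c : ℝ) (X : TangentSpace (𝓡 n) y) :
    chartVec i y (c • X) = c • chartVec i y X :=
  (tangentChange (achart 𝔼 y) i y).map_smul c X

theorem chartVec_sum (i : atlas 𝔼 M) (y : M) {ι : Type*} (t : Finset ι)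
    (X : ι → TangentSpace (𝓡 n) y) :
    chartVec i y (∑ a ∈ t, X a) = ∑ a ∈ t, chartVec i y (X a) :=
  map_sum (tangentChange (achart 𝔼 y) i y) X t

/-- The vector field with constant coordinates `v` in the chart `i`. -/
def frame (i : atlas 𝔼 M) (v : 𝔼) (y : M) : TangentSpace (𝓡 n) y :=
  tangentChange i (achart 𝔼 y) y v

theorem chartVec_frame (i : atlas 𝔼 M) (v : 𝔼) {y : M} (hy : y ∈ i.1.source) :
    chartVec i y (frame i v y) = v :=
  (tangentChange_tangentChange i _ i hy (mem_chart_source 𝔼 y) hy v).trans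
    (tangentChange_apply_self i hy v)

theorem frame_chartVec (i : atlas 𝔼 M) {y : M} (hy : y ∈ i.1.source) (X : TangentSpace (𝓡 n) y) :
    frame i (chartVec i y X) y = X :=
  (tangentChange_tangentChange _ i _ (mem_chart_source 𝔼 y) hy (mem_chart_source 𝔼 y) X).trans
    (tangentChange_apply_self _ (mem_chart_source 𝔼 y) X)

theorem frame_sum_smul (i : atlas 𝔼 M) (y : M) {ι : Type*} (t : Finset ι) (c : ι → ℝ)
    (v : ι → 𝔼) : frame i (∑ a ∈ t, c a • v a) y = ∑ a ∈ t, c a • frame i (v a) y := by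
  have h := map_sum (tangentChange i (achart 𝔼 y) y) (fun a => c a • v a) t
  simp only [map_smul] at h
  exact h

theorem vectorCoord_frame (i : atlas 𝔼 M) (v : 𝔼) {z : 𝔼} (hz : z ∈ i.1.target) :
    vectorCoord i (frame i v) z = v :=
  chartVec_frame i v (i.1.map_target hz)

theorem mdifferentiableAt_frame (i : atlas 𝔼 M) (v : 𝔼) {y : M} (hy : y ∈ i.1.source) :
    MDifferentiableAt (𝓡 n) (𝓡 n).tangent
      (fun y => (⟨y, frame i v y⟩ : TangentBundle (𝓡 n) M)) y := by
  rw [mdifferentiableAt_vectorField_iff i _ hy]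
  refine (differentiableAt_const v).congr_of_eventuallyEq ?_
  filter_upwards [i.1.open_target.mem_nhds (i.1.map_source hy)] with z hz
    using vectorCoord_frame i v hz

theorem hasMFDerivAt_comp_chart (i : atlas 𝔼 M) {y : M} (hy : y ∈ i.1.source) {g : 𝔼 → G}
    (hg : DifferentiableAt ℝ g (i.1 y)) :
    HasMFDerivAt (𝓡 n) 𝓘(ℝ, G) (fun y' => g (i.1 y')) y
      ((fderiv ℝ g (i.1 y)).comp (tangentChange (achart 𝔼 y) i y)) := by
  refine ⟨ContinuousAt.comp (f := i.1) hg.continuousAt (i.1.continuousAt hy), ?_⟩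
  have h := hasFDerivAt_trans (achart 𝔼 y) i ⟨mem_chart_source 𝔼 y, hy⟩
  have hg' := hg.hasFDerivAt
  have e : (achart 𝔼 y).1.symm ((achart 𝔼 y).1 y) = y :=
    (achart 𝔼 y).1.left_inv (mem_chart_source 𝔼 y)
  rw [show i.1 y = i.1 ((achart 𝔼 y).1.symm ((achart 𝔼 y).1 y)) by rw [e]] at hg'
  have h2 := (HasFDerivAt.comp (f := fun z => i.1 ((achart 𝔼 y).1.symm z))
    ((achart 𝔼 y).1 y) hg' h).hasFDerivWithinAt (s := Set.range (𝓡 n))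
  rw [e] at h2
  exact h2

theorem mvfderiv_comp_chart (i : atlas 𝔼 M) {y : M} (hy : y ∈ i.1.source) {g : 𝔼 → ℝ}
    (hg : DifferentiableAt ℝ g (i.1 y)) (X : TangentSpace (𝓡 n) y) :
    mvfderiv (𝓡 n) (fun y' => g (i.1 y')) y X = fderiv ℝ g (i.1 y) (chartVec i y X) := by
  rw [mvfderiv, (hasMFDerivAt_comp_chart i hy hg).mfderiv]
  rfl

theorem AffineConnection.sum_smul (nabla : AffineConnection n M) {y : M} {ι : Type*}
    (t : Finset ι) (c : ι → M → ℝ) (s : ι → Π y : M, TangentSpace (𝓡 n) y)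
    (hc : ∀ a ∈ t, MDifferentiableAt (𝓡 n) 𝓘(ℝ, ℝ) (c a) y)
    (hs : ∀ a ∈ t, MDifferentiableAt (𝓡 n) (𝓡 n).tangent
      (fun y => (⟨y, s a y⟩ : TangentBundle (𝓡 n) M)) y) :
    nabla (fun y => ∑ a ∈ t, c a y • s a y) y = ∑ a ∈ t, (c a y • nabla (s a) y +
      (mvfderiv (𝓡 n) (c a) y).smulRight (s a y)) := by
  classical
  have hnabla := nabla.isCovariantDerivativeOnUniv
  induction t using Finset.induction_on with
  | empty =>
    simp only [Finset.sum_empty]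
    exact hnabla.zero
  | insert a t ha ih =>
    simp only [Finset.mem_insert, forall_eq_or_imp] at hc hs
    have h1 := MDifferentiableAt.smul_section hc.1 hs.1
    have h2 := MDifferentiableAt.sum_section (s := t) (t := fun a y => c a y • s a y) fun b hb =>
      MDifferentiableAt.smul_section (hc.2 b hb) (hs.2 b hb)
    have h3 := hnabla.add h1 h2
    have h4 := hnabla.leibniz hs.1 hc.1
    rw [Finset.sum_insert ha, ← ih hc.2 hs.2, ← h4, ← h3]
    congr 1
    funext y
    simp [Finset.sum_insert ha]

/-- The coordinates of `∇_a ∂_b` in the chart `i`. -/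
def christoffelCoeff (nabla : AffineConnection n M) (i : atlas 𝔼 M) (a b : Fin n) : 𝔼 → 𝔼 :=
  vectorCoord i fun y => nabla (frame i (EuclideanSpace.single b 1)) y
    (frame i (EuclideanSpace.single a 1) y)

/-- The Christoffel symbols in the chart `i`. -/
def chartChristoffel (nabla : AffineConnection n M) (i : atlas 𝔼 M) (z : 𝔼) :
    𝔼 →L[ℝ] 𝔼 →L[ℝ] 𝔼 :=
  ∑ a, ∑ b, (EuclideanSpace.proj a : 𝔼 →L[ℝ] ℝ).smulRight
    ((EuclideanSpace.proj b : 𝔼 →L[ℝ] ℝ).smulRight (christoffelCoeff nabla i a b z))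

theorem chartChristoffel_apply (nabla : AffineConnection n M) (i : atlas 𝔼 M) (z X v : 𝔼) :
    chartChristoffel nabla i z X v = ∑ a, ∑ b, X a • v b • christoffelCoeff nabla i a b z := by
  simp [chartChristoffel]

theorem euclidean_eq_sum (v : 𝔼) : v = ∑ a, v a • EuclideanSpace.single a (1 : ℝ) := by
  ext j
  simp [Finset.sum_apply, Pi.single_apply]

/-- The coordinates of the covariant derivative in the chart `i`. -/
theorem chartVec_connection (nabla : AffineConnection n M) (i : atlas 𝔼 M)
    (s : Π y : M, TangentSpace (𝓡 n) y) {y : M} (hy : y ∈ i.1.source)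
    (hs : DifferentiableAt ℝ (vectorCoord i s) (i.1 y)) (X : TangentSpace (𝓡 n) y) :
    chartVec i y (nabla s y X) = fderiv ℝ (vectorCoord i s) (i.1 y) (chartVec i y X) +
      chartChristoffel nabla i (i.1 y) (chartVec i y X) (vectorCoord i s (i.1 y)) := by
  let c : Fin n → M → ℝ := fun b y' => vectorCoord i s (i.1 y') b
  have hg : ∀ b, HasFDerivAt (fun z => vectorCoord i s z b)
      ((EuclideanSpace.proj b : 𝔼 →L[ℝ] ℝ).comp (fderiv ℝ (vectorCoord i s) (i.1 y))) (i.1 y) :=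
    fun b => (EuclideanSpace.proj b : 𝔼 →L[ℝ] ℝ).hasFDerivAt.comp (i.1 y) hs.hasFDerivAt
  have hc : ∀ b, MDifferentiableAt (𝓡 n) 𝓘(ℝ, ℝ) (c b) y := fun b =>
    (hasMFDerivAt_comp_chart i hy (hg b).differentiableAt).mdifferentiableAt
  have hf := fun b : Fin n => mdifferentiableAt_frame i (EuclideanSpace.single b (1 : ℝ)) hy
  have hloc : ∀ᶠ y' in nhds y, s y' = ∑ b, c b y' • frame i (EuclideanSpace.single b 1) y' := by
    filter_upwards [i.1.open_source.mem_nhds hy] with y' hy'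
    rw [← frame_sum_smul, ← euclidean_eq_sum, vectorCoord_chart i s hy', frame_chartVec i hy']
  -- A connection depends only on the germ of the section, so `s` may be replaced by its expansion
  -- in the coordinate frame, to which the Leibniz rule applies.
  have h1 : nabla s y =
      nabla (fun y' => ∑ b, c b y' • frame i (EuclideanSpace.single b 1) y') y :=
    nabla.isCovariantDerivativeOnUniv.congr_of_eventuallyEq
    ((mdifferentiableAt_vectorField_iff i s hy).2 hs)
    (MDifferentiableAt.sum_section fun b _ => MDifferentiableAt.smul_section (hc b) (hf b))
    Filter.univ_mem hloc
  rw [h1, AffineConnection.sum_smul nabla _ c _ (fun b _ => hc b) fun b _ => hf b]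
  have hfr : ∀ b, chartVec i y (nabla (frame i (EuclideanSpace.single b 1)) y X) =
      ∑ a, chartVec i y X a • christoffelCoeff nabla i a b (i.1 y) := by
    intro b
    have hX : X = ∑ a, chartVec i y X a • frame i (EuclideanSpace.single a 1) y := by
      rw [← frame_sum_smul, ← euclidean_eq_sum, frame_chartVec i hy]
    conv_lhs => rw [hX]
    rw [map_sum, chartVec_sum]
    refine Finset.sum_congr rfl fun a _ => ?_
    rw [map_smul, chartVec_smul, christoffelCoeff, vectorCoord_chart i _ hy]
  have hterm : ∀ b, chartVec i y ((c b y • nabla (frame i (EuclideanSpace.single b 1)) y +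
      (mvfderiv (𝓡 n) (c b) y).smulRight (frame i (EuclideanSpace.single b 1) y)) X) =
      vectorCoord i s (i.1 y) b • (∑ a, chartVec i y X a • christoffelCoeff nabla i a b (i.1 y)) +
      fderiv ℝ (vectorCoord i s) (i.1 y) (chartVec i y X) b • EuclideanSpace.single b (1 : ℝ) := by
    intro b
    rw [← hfr]
    have e : (c b y • nabla (frame i (EuclideanSpace.single b 1)) y +
      (mvfderiv (𝓡 n) (c b) y).smulRight (frame i (EuclideanSpace.single b 1) y)) X =
      c b y • nabla (frame i (EuclideanSpace.single b 1)) y X +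
      mvfderiv (𝓡 n) (c b) y X • frame i (EuclideanSpace.single b 1) y := rfl
    rw [e, chartVec_add, chartVec_smul, chartVec_smul, chartVec_frame i _ hy,
      mvfderiv_comp_chart i hy (hg b).differentiableAt, (hg b).fderiv]
    rfl
  rw [_root_.sum_apply, chartVec_sum, Finset.sum_congr rfl fun b _ => hterm b,
    Finset.sum_add_distrib, ← euclidean_eq_sum, add_comm, chartChristoffel_apply,
    Finset.sum_comm]
  congr 1
  refine Finset.sum_congr rfl fun b _ => ?_
  rw [Finset.smul_sum]
  exact Finset.sum_congr rfl fun a _ => smul_comm _ _ _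

theorem hasConnectionForm_deriv (nabla : AffineConnection n M) (i : atlas 𝔼 M) :
    HasConnectionForm (tangentBundleCore (𝓡 n) M) nabla.deriv i (chartChristoffel nabla i) :=
  fun s _ hy hs X => chartVec_connection nabla i s hy hs X

theorem contMDiffAt_vectorField_iff (i : atlas 𝔼 M) (s : Π y : M, TangentSpace (𝓡 n) y)
    {y : M} (hy : y ∈ i.1.source) :
    ContMDiffAt (𝓡 n) (𝓡 n).tangent ∞ (fun y => (⟨y, s y⟩ : TangentBundle (𝓡 n) M)) y ↔
      ContMDiffAt (𝓡 n) 𝓘(ℝ, 𝔼) ∞ (fun y => chartVec i y (s y)) y := by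
  have : ContMDiffVectorBundle ∞ 𝔼 (tangentBundleCore (𝓡 n) M).Fiber (𝓡 n) :=
    (inferInstance : ContMDiffVectorBundle ∞ 𝔼 (TangentSpace (𝓡 n) : M → Type _) (𝓡 n))
  have : MemTrivializationAtlas ((tangentBundleCore (𝓡 n) M).localTriv i) := ⟨⟨i, rfl⟩⟩
  exact Bundle.Trivialization.contMDiffAt_section_iff (IB := 𝓡 n) (n := ∞)
    (E := (tangentBundleCore (𝓡 n) M).Fiber) (s := s)
    ((tangentBundleCore (𝓡 n) M).localTriv i) (x₀ := y) hy

theorem contMDiffAt_frame (i : atlas 𝔼 M) (v : 𝔼) {y : M} (hy : y ∈ i.1.source) :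
    ContMDiffAt (𝓡 n) (𝓡 n).tangent ∞
      (fun y => (⟨y, frame i v y⟩ : TangentBundle (𝓡 n) M)) y := by
  rw [contMDiffAt_vectorField_iff i _ hy]
  refine (contMDiffAt_const (c := v)).congr_of_eventuallyEq ?_
  filter_upwards [i.1.open_source.mem_nhds hy] with y' hy' using chartVec_frame i v hy'

/-- Smoothness of the connection is applied to a globally smooth field, whereas the coordinate frame
is smooth only on the chart domain. The frame is therefore multiplied by a bump function supported
in the chart, for which `M` has to be Hausdorff. -/
theorem contDiffAt_christoffelCoeff [T2Space M] {nabla : AffineConnection n M}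
    (h : nabla.ContMDiffCovariantDerivative ∞) (i : atlas 𝔼 M) {y : M} (hy : y ∈ i.1.source)
    (a b : Fin n) : ContDiffAt ℝ ∞ (christoffelCoeff nabla i a b) (i.1 y) := by
  set va : 𝔼 := EuclideanSpace.single a 1
  set vb : 𝔼 := EuclideanSpace.single b 1
  obtain ⟨ρ, -, hρ⟩ := (SmoothBumpFunction.nhds_basis_tsupport (I := 𝓡 n) y).mem_iff.1
    (i.1.open_source.mem_nhds hy)
  have hσ := ContMDiffOn.smul_section_of_tsupport (n := ∞) (V := (TangentSpace (𝓡 n) : M → Type _))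
    (F := 𝔼) ρ.contMDiff.contMDiffOn i.1.open_source hρ fun y' hy' =>
      (contMDiffAt_frame i vb hy').contMDiffWithinAt
  have hcov := h.contMDiff.contMDiff (σ := (ρ : M → ℝ) • frame i vb) hσ.contMDiffOn
  have h1 := (hcov.contMDiffAt (x := y) Filter.univ_mem).clm_bundle_apply
    (contMDiffAt_frame i va hy)
  have h2 := (contMDiffAt_vectorField_iff i
    (fun y => nabla ((ρ : M → ℝ) • frame i vb) y (frame i va y)) hy).1 h1
  have h3 := (contMDiffOn_symm_of_mem_maximalAtlas (I := 𝓡 n) (n := ∞)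
    (IsManifold.subset_maximalAtlas i.2)).contMDiffAt
    (i.1.open_target.mem_nhds (i.1.map_source hy))
  have h2' := (congrArg (ContMDiffAt (𝓡 n) 𝓘(ℝ, 𝔼) ∞ fun y' => chartVec i y'
    (nabla ((ρ : M → ℝ) • frame i vb) y' (frame i va y'))) (i.1.left_inv hy)).mpr h2
  refine (h2'.comp (i.1 y) h3).contDiffAt.congr_of_eventuallyEq ?_
  -- The cut-off must equal `1` in a neighbourhood of every nearby point, since the covariant
  -- derivative there depends on the germ.
  have hev : ∀ᶠ y' in nhds y, ∀ᶠ y'' in nhds y', ρ y'' = 1 :=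
    eventually_eventually_nhds.2 ρ.eventuallyEq_one
  have hcont := i.1.continuousAt_symm (i.1.map_source hy)
  rw [ContinuousAt, i.1.left_inv hy] at hcont
  filter_upwards [hcont.eventually hev, i.1.open_target.mem_nhds (i.1.map_source hy)]
    with z hz hzt
  have h4 : nabla (frame i vb) (i.1.symm z) = nabla ((ρ : M → ℝ) • frame i vb) (i.1.symm z) := by
    refine nabla.isCovariantDerivativeOnUniv.congr_of_eventuallyEq
      (mdifferentiableAt_frame i vb (i.1.map_target hzt))
      (hσ.contMDiffAt.mdifferentiableAt (by simp)) Filter.univ_mem ?_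
    filter_upwards [hz] with y' hy'
    simp [hy']
  simp only [christoffelCoeff, vectorCoord, Function.comp_apply]
  exact congrArg (fun L => chartVec i (i.1.symm z) (L (frame i va (i.1.symm z)))) h4

theorem contDiffAt_chartChristoffel [T2Space M] {nabla : AffineConnection n M}
    (h : nabla.ContMDiffCovariantDerivative ∞) (i : atlas 𝔼 M) {y : M} (hy : y ∈ i.1.source) :
    ContDiffAt ℝ ∞ (chartChristoffel nabla i) (i.1 y) := by
  unfold chartChristoffel
  refine ContDiffAt.sum fun a _ => ContDiffAt.sum fun b _ => ?_
  exact contDiffAt_const.smulRight (contDiffAt_const.smulRight (contDiffAt_christoffelCoeff h i hy a b))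

end Christoffel
end ProjectiveTractor
end

noncomputable section

namespace ProjectiveTractor

/-! ### Change of chart and of Weyl connection -/

section Transformation

variable {n : ℕ} {M : Type*} [TopologicalSpace M]
  [ChartedSpace (EuclideanSpace ℝ (Fin n)) M] [IsManifold (𝓡 n) ∞ M]
  {G : Type*} [NormedAddCommGroup G] [NormedSpace ℝ G]

local notation "𝔼" => EuclideanSpace ℝ (Fin n)

theorem vectorCoord_frame_eventuallyEq (i : atlas 𝔼 M) (v : 𝔼) {y : M} (hy : y ∈ i.1.source) :
    vectorCoord i (frame i v) =ᶠ[nhds (i.1 y)] fun _ => v := by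
  filter_upwards [i.1.open_target.mem_nhds (i.1.map_source hy)] with z hz
    using vectorCoord_frame i v hz

theorem chartChristoffel_frame (nabla : AffineConnection n M) (i : atlas 𝔼 M) {y : M}
    (hy : y ∈ i.1.source) (X v : 𝔼) :
    chartChristoffel nabla i (i.1 y) X v = chartVec i y (nabla (frame i v) y (frame i X y)) := by
  have hev := vectorCoord_frame_eventuallyEq i v hy
  rw [chartVec_connection nabla i (frame i v) hy
    ((differentiableAt_const v).congr_of_eventuallyEq hev), hev.fderiv_eq, hev.self_of_nhds,
    chartVec_frame i X hy]
  simp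

theorem chartVec_sub (i : atlas 𝔼 M) (y : M) (X Y : TangentSpace (𝓡 n) y) :
    chartVec i y (X - Y) = chartVec i y X - chartVec i y Y :=
  (tangentChange (achart 𝔼 y) i y).map_sub X Y

/-- Coordinate fields commute, so their torsion is the skew part of the Christoffel symbols. -/
theorem chartChristoffel_symm {nabla : AffineConnection n M} (h : nabla.torsion = 0)
    (i : atlas 𝔼 M) {y : M} (hy : y ∈ i.1.source) (X v : 𝔼) :
    chartChristoffel nabla i (i.1 y) X v = chartChristoffel nabla i (i.1 y) v X := by
  have h1 := (CovariantDerivative.torsion_eq_zero_iff nabla).1 h (mdifferentiableAt_frame i X hy)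
    (mdifferentiableAt_frame i v hy)
  have h2 := congrArg (chartVec i y) h1
  rw [chartVec_sub, vectorCoord_mlieBracket i hy (mdifferentiableAt_frame i X hy)
    (mdifferentiableAt_frame i v hy), Filter.EventuallyEq.lieBracket_vectorField_eq
      (vectorCoord_frame_eventuallyEq i X hy) (vectorCoord_frame_eventuallyEq i v hy)] at h2
  rw [chartChristoffel_frame nabla i hy, chartChristoffel_frame nabla i hy, ← sub_eq_zero, h2]
  simp [VectorField.lieBracket]

theorem eventually_chartChristoffel_symm {nabla : AffineConnection n M} (h : nabla.torsion = 0)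
    (i : atlas 𝔼 M) {y : M} (hy : y ∈ i.1.source) :
    ∀ᶠ z in nhds (i.1 y), ∀ X v, chartChristoffel nabla i z X v = chartChristoffel nabla i z v X := by
  filter_upwards [i.1.open_target.mem_nhds (i.1.map_source hy)] with z hz X v
  have h1 := chartChristoffel_symm h i (i.1.map_target hz) X v
  rwa [i.1.right_inv hz] at h1

theorem thomas_chartChristoffel_eq {nabla nabla' : AffineConnection n M}
    (h : ProjectivelyEquivalent nabla nabla') (i : atlas 𝔼 M) {y : M} (hy : y ∈ i.1.source) :
    thomas (chartChristoffel nabla i) =ᶠ[nhds (i.1 y)] thomas (chartChristoffel nabla' i) := by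
  obtain ⟨Υ, -, hΥ⟩ := h
  filter_upwards [i.1.open_target.mem_nhds (i.1.map_source hy)] with z hz
  set y' := i.1.symm z
  have hy' := i.1.map_target hz
  let Υ' : 𝔼 →L[ℝ] ℝ := (show 𝔼 →L[ℝ] ℝ from Υ y').comp (tangentChange i (achart 𝔼 y') y')
  refine (thomas_eq_of_projective Υ' fun X v => ?_).symm
  have h1 := congrArg (chartVec i y')
    (hΥ (frame i v) y' (mdifferentiableAt_frame i v hy') (frame i X y'))
  rw [chartVec_add, chartVec_add, chartVec_smul, chartVec_smul,
    ← chartChristoffel_frame nabla' i hy', ← chartChristoffel_frame nabla i hy',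
    chartVec_frame i v hy', chartVec_frame i X hy', i.1.right_inv hz] at h1
  exact h1

theorem fderiv_chart_change (i j : atlas 𝔼 M) {y : M} (hi : y ∈ i.1.source) (hj : y ∈ j.1.source)
    {f : M → G} (hf : DifferentiableAt ℝ (fun z => f (j.1.symm z)) (j.1 y)) :
    HasFDerivAt (fun z => f (i.1.symm z))
      ((fderiv ℝ (fun z => f (j.1.symm z)) (j.1 y)).comp (tangentChange i j y)) (i.1 y) := by
  have hf' := hf.hasFDerivAt
  rw [show j.1 y = j.1 (i.1.symm (i.1 y)) by rw [i.1.left_inv hi]] at hf'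
  have h2 := hf'.comp (i.1 y) (hasFDerivAt_trans i j ⟨hi, hj⟩)
  rw [i.1.left_inv hi] at h2
  refine h2.congr_of_eventuallyEq ?_
  filter_upwards [(i.1.symm ≫ₕ j.1).open_source.mem_nhds (mem_overlap' i j ⟨hi, hj⟩)] with z hz
  simp [j.1.left_inv (mem_overlap i j hz).2]

/-- The transformation law of the Christoffel symbols. -/
theorem chartChristoffel_change (nabla : AffineConnection n M) (i j : atlas 𝔼 M) {y : M}
    (hi : y ∈ i.1.source) (hj : y ∈ j.1.source) (X v : 𝔼) :
    chartChristoffel nabla j (j.1 y) (tangentChange i j y X) (tangentChange i j y v) =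
      tangentChange i j y (chartChristoffel nabla i (i.1 y) X v) -
        fderiv ℝ (fun z => tangentChange i j (i.1.symm z)) (i.1 y) X v := by
  -- A coordinate field of the chart `i` is not constant in the chart `j`; its derivative there is
  -- the inhomogeneous term.
  have hev : vectorCoord j (frame i v) =ᶠ[nhds (j.1 y)]
      fun z => tangentChange i j (j.1.symm z) v := by
    filter_upwards [(j.1.symm ≫ₕ i.1).open_source.mem_nhds (mem_overlap' j i ⟨hj, hi⟩)] with z hz
    have hz' := mem_overlap j i hz
    exact tangentChange_tangentChange i _ j hz'.2 (mem_chart_source 𝔼 _) hz'.1 v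
  have hd := (contDiffAt_tangentChange' j i hj hi).differentiableAt (by simp)
  have hd' := hd.hasFDerivAt.clm_apply (hasFDerivAt_const v (j.1 y))
  have hX : chartVec j y (frame i X y) = tangentChange i j y X :=
    tangentChange_tangentChange i _ j hi (mem_chart_source 𝔼 _) hj X
  have h1 := chartVec_connection nabla j (frame i v) hj
    (hd'.differentiableAt.congr_of_eventuallyEq hev) (frame i X y)
  rw [hev.fderiv_eq, hd'.fderiv, hev.self_of_nhds, hX] at h1
  simp only [j.1.left_inv hj] at h1
  have h2 : chartVec j y (nabla (frame i v) y (frame i X y)) =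
      tangentChange i j y (chartChristoffel nabla i (i.1 y) X v) := by
    rw [chartChristoffel_frame nabla i hi]
    exact (tangentChange_tangentChange _ i j (mem_chart_source 𝔼 _) hi hj _).symm
  rw [(fderiv_chart_change i j hi hj hd).fderiv, ← h2, h1]
  simp

theorem det_id_add_smul_hasDerivAt (B : 𝔼 →L[ℝ] 𝔼) :
    HasDerivAt (fun t : ℝ => (ContinuousLinearMap.id ℝ 𝔼 + t • B).det) (traceL 𝔼 B) 0 := by
  let b := (EuclideanSpace.basisFun (Fin n) ℝ).toBasis
  let m := LinearMap.toMatrix b b (B : 𝔼 →ₗ[ℝ] 𝔼)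
  -- `r` is the remainder in `det (1 + t m) = 1 + t tr m + r(t) t²`, so only the trace survives in
  -- the derivative at `0`.
  let r := (Matrix.det (1 + (Polynomial.X : Polynomial ℝ) • m.map Polynomial.C)).divX.divX
  have h : (fun t : ℝ => (ContinuousLinearMap.id ℝ 𝔼 + t • B).det) =
      fun t => 1 + m.trace * t + r.eval t * t ^ 2 := by
    ext t
    rw [← Matrix.det_one_add_smul]
    change LinearMap.det ((LinearMap.id : 𝔼 →ₗ[ℝ] 𝔼) + t • (B : 𝔼 →ₗ[ℝ] 𝔼)) = _
    rw [← LinearMap.det_toMatrix b, map_add, map_smul, LinearMap.toMatrix_id]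
  rw [h, show traceL 𝔼 B = m.trace by rw [traceL_apply, LinearMap.trace_eq_matrix_trace ℝ b]]
  have h1 := (((hasDerivAt_id (0 : ℝ)).const_mul m.trace).const_add 1).add
    ((r.hasDerivAt 0).mul ((hasDerivAt_id (0 : ℝ)).pow 2))
  have h2 : HasDerivAt (fun t => 1 + m.trace * t + r.eval t * t ^ 2) _ 0 := h1
  convert h2 using 1
  simp

theorem fderiv_det_id (B : 𝔼 →L[ℝ] 𝔼) :
    fderiv ℝ (fun A : 𝔼 →L[ℝ] 𝔼 => A.det) (ContinuousLinearMap.id ℝ 𝔼) B = traceL 𝔼 B := by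
  have h : HasFDerivAt (fun A : 𝔼 →L[ℝ] 𝔼 => A.det)
      (fderiv ℝ (fun A : 𝔼 →L[ℝ] 𝔼 => A.det) (ContinuousLinearMap.id ℝ 𝔼))
      (ContinuousLinearMap.id ℝ 𝔼 + (0 : ℝ) • B) := by
    have e : ContinuousLinearMap.id ℝ 𝔼 + (0 : ℝ) • B = ContinuousLinearMap.id ℝ 𝔼 := by
      ext1 v
      simp only [add_apply, smul_apply, zero_smul, add_zero]
    rw [e]
    exact ((contDiff_det (n := n)).differentiable (by simp) _).hasFDerivAt
  have h1 : HasDerivAt (fun t : ℝ => ContinuousLinearMap.id ℝ 𝔼 + t • B) B 0 := by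
    simpa using ((hasDerivAt_id (0 : ℝ)).smul_const B).const_add (ContinuousLinearMap.id ℝ 𝔼)
  have h3' := h.comp_hasDerivAt (0 : ℝ) h1
  have h3 : HasDerivAt (fun t : ℝ => (ContinuousLinearMap.id ℝ 𝔼 + t • B).det) _ 0 := h3'
  exact h3.unique (det_id_add_smul_hasDerivAt B)

/-- Jacobi's formula for the logarithmic derivative of a determinant. Composing with the fixed
inverse `tangentChange j i y` moves the base point to the identity, where the derivative of `det` is
the trace, and changes the logarithm only by a constant. -/
theorem dLogDensity_apply (i j : atlas 𝔼 M) {y : M} (hi : y ∈ i.1.source) (hj : y ∈ j.1.source)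
    (X : 𝔼) : dLogDensity i j y X = ((n : ℝ) + 1)⁻¹ * traceL 𝔼 ((tangentChange j i y).comp
      (fderiv ℝ (fun z => tangentChange i j (i.1.symm z)) (i.1 y) X)) := by
  set T : 𝔼 → 𝔼 →L[ℝ] 𝔼 := fun z => tangentChange i j (i.1.symm z) with hT
  have hTd : HasFDerivAt T (fderiv ℝ T (i.1 y)) (i.1 y) :=
    ((contDiffAt_tangentChange i j hi hj).differentiableAt (by simp)).hasFDerivAt
  have hTy : T (i.1 y) = tangentChange i j y := by rw [hT]; simp only [i.1.left_inv hi]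
  have hinv : (tangentChange j i y).comp (T (i.1 y)) = ContinuousLinearMap.id ℝ 𝔼 := by
    rw [hTy, tangentChange_comp i j i ⟨⟨hi, hj⟩, hi⟩, tangentChange_self i hi]
  have h0 := det_tangentChange_ne_zero i j ⟨hi, hj⟩
  have hdet : HasFDerivAt (fun A : 𝔼 →L[ℝ] 𝔼 => A.det)
      (fderiv ℝ (fun A : 𝔼 →L[ℝ] 𝔼 => A.det) (ContinuousLinearMap.id ℝ 𝔼))
      ((tangentChange j i y).comp (T (i.1 y))) := by
    rw [hinv]
    exact ((contDiff_det (n := n)).differentiable (by simp) _).hasFDerivAt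
  have hcomp' := hdet.comp (i.1 y)
    ((hasFDerivAt_const (tangentChange j i y) (i.1 y)).clm_comp hTd)
  have hcomp : HasFDerivAt (fun z => ((tangentChange j i y).comp (T z)).det) _ (i.1 y) := hcomp'
  have hne : ((tangentChange j i y).comp (T (i.1 y))).det ≠ 0 := by
    rw [det_comp', hTy]; exact mul_ne_zero (det_tangentChange_ne_zero j i ⟨hj, hi⟩) h0
  have hlog := (hcomp.log hne).const_mul ((n : ℝ) + 1)⁻¹
  have hlog' := hlog.add_const
    (((n : ℝ) + 1)⁻¹ * Real.log (tangentChange i j y).det)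
  have hev : (fun z => Real.log (densityFactor 1 i j (i.1.symm z))) =ᶠ[nhds (i.1 y)] fun z =>
      ((n : ℝ) + 1)⁻¹ * Real.log ((tangentChange j i y).comp (T z)).det +
        ((n : ℝ) + 1)⁻¹ * Real.log (tangentChange i j y).det := by
    filter_upwards [(i.1.symm ≫ₕ j.1).open_source.mem_nhds (mem_overlap' i j ⟨hi, hj⟩)] with z hz
    have h1 := det_tangentChange_ne_zero i j (mem_overlap i j hz)
    have h2 : (tangentChange i j y).det * (tangentChange j i y).det = 1 := by
      rw [mul_comm, ← det_comp', ← hTy, hinv]; exact LinearMap.det_id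
    rw [densityFactor, Real.log_rpow (abs_pos.2 h1), Real.log_abs, ← mul_add, ← Real.log_mul _ h0,
      det_comp', mul_right_comm, mul_comm (tangentChange j i y).det, h2, one_mul, one_div]
    rw [det_comp']
    exact mul_ne_zero (det_tangentChange_ne_zero j i ⟨hj, hi⟩) h1
  rw [dLogDensity, hev.fderiv_eq, hlog'.fderiv]
  have h3 : ((tangentChange j i y).comp (T (i.1 y))).det = 1 := by rw [hinv]; exact LinearMap.det_id
  simp [h3, fderiv_det_id]

/-- The transformation law of the connection form on `E(1)`. -/
theorem traceForm_change (nabla : AffineConnection n M) (i j : atlas 𝔼 M) {y : M}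
    (hi : y ∈ i.1.source) (hj : y ∈ j.1.source) (X : 𝔼) :
    traceForm (chartChristoffel nabla j) (j.1 y) (tangentChange i j y X) =
      traceForm (chartChristoffel nabla i) (i.1 y) X - dLogDensity i j y X := by
  have hinv : (tangentChange j i y).comp (tangentChange i j y) = ContinuousLinearMap.id ℝ 𝔼 := by
    rw [tangentChange_comp i j i ⟨⟨hi, hj⟩, hi⟩, tangentChange_self i hi]
  have hinv' : (tangentChange i j y).comp (tangentChange j i y) = ContinuousLinearMap.id ℝ 𝔼 := by
    rw [tangentChange_comp j i j ⟨⟨hj, hi⟩, hj⟩, tangentChange_self j hj]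
  set D := fderiv ℝ (fun z => tangentChange i j (i.1.symm z)) (i.1 y) X with hD
  have h1 : (chartChristoffel nabla j (j.1 y) (tangentChange i j y X)).comp (tangentChange i j y) =
      (tangentChange i j y).comp (chartChristoffel nabla i (i.1 y) X) - D := by
    ext1 v
    exact chartChristoffel_change nabla i j hi hj X v
  -- After conjugation the homogeneous part keeps its trace, while the inhomogeneous part
  -- contributes the trace in `dLogDensity_apply`.
  have h2 := congrArg (fun L => traceL 𝔼 ((tangentChange j i y).comp L)) h1
  simp only [ContinuousLinearMap.comp_sub, map_sub] at h2
  rw [traceL_comm, ContinuousLinearMap.comp_assoc, hinv', ← ContinuousLinearMap.comp_assoc, hinv,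
    ContinuousLinearMap.comp_id, ContinuousLinearMap.id_comp] at h2
  rw [dLogDensity_apply i j hi hj, ← hD]
  simp only [traceForm, smul_apply, ContinuousLinearMap.comp_apply, h2, finrank_euclideanSpace,
    Fintype.card_fin, smul_eq_mul]
  ring

end Transformation
end ProjectiveTractor
end

noncomputable section

namespace ProjectiveTractor

/-! ### The induced connections on `E(w)` and `TM(w)` in a fixed chart -/

section Weighted

variable {n : ℕ} {M : Type*} [TopologicalSpace M]
  [ChartedSpace (EuclideanSpace ℝ (Fin n)) M] [IsManifold (𝓡 n) ∞ M]
  {G : Type*} [NormedAddCommGroup G] [NormedSpace ℝ G]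

local notation "𝔼" => EuclideanSpace ℝ (Fin n)

theorem chartVec_achart (y : M) (X : TangentSpace (𝓡 n) y) : chartVec (achart 𝔼 y) y X = X :=
  tangentChange_apply_self _ (mem_chart_source 𝔼 y) X

theorem tangentChange_chartVec (i : atlas 𝔼 M) {y : M} (hy : y ∈ i.1.source)
    (X : TangentSpace (𝓡 n) y) : tangentChange i (achart 𝔼 y) y (chartVec i y X) = X :=
  frame_chartVec i hy X

/-- The extension of `v` is constant in the preferred chart, so its covariant derivative has no
derivative term. -/
theorem christoffel_eq (nabla : AffineConnection n M) (y : M) (X v : TangentSpace (𝓡 n) y) :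
    christoffel nabla y X v =
      chartChristoffel nabla (achart 𝔼 y) ((achart 𝔼 y).1 y) (X : 𝔼) (v : 𝔼) := by
  have hy : y ∈ (achart 𝔼 y).1.source := mem_chart_source 𝔼 y
  obtain ⟨v', hv⟩ : ∃ v' : 𝔼, v' = v := ⟨v, rfl⟩
  have hev : vectorCoord (achart 𝔼 y) (FiberBundle.extend 𝔼 v) =ᶠ[nhds ((achart 𝔼 y).1 y)]
      fun _ => v' := by
    filter_upwards [vectorCoord_extend (achart 𝔼 y) hy v,
      (achart 𝔼 y).1.open_target.mem_nhds ((achart 𝔼 y).1.map_source hy)] with z hz hz'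
    rw [hz, ← hv]
    exact tangentChange_apply_self _ ((achart 𝔼 y).1.map_target hz') v'
  have h := chartVec_connection nabla (achart 𝔼 y) (FiberBundle.extend 𝔼 v) hy
    ((differentiableAt_const _).congr_of_eventuallyEq hev) X
  rw [hev.fderiv_eq, hev.self_of_nhds] at h
  have h' := (chartVec_achart y _).symm.trans h
  rw [christoffel]
  refine h'.trans ?_
  rw [fderiv_fun_const, chartVec_achart, ← hv]
  exact zero_add _

theorem traceL_euclidean (A : 𝔼 →L[ℝ] 𝔼) :
    traceL 𝔼 A = ∑ a, A (EuclideanSpace.single a 1) a := by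
  rw [traceL_apply, LinearMap.trace_eq_matrix_trace ℝ (EuclideanSpace.basisFun (Fin n) ℝ).toBasis,
    Matrix.trace]
  simp [LinearMap.toMatrix_apply]

theorem densityForm_eq (nabla : AffineConnection n M) (y : M) (X : TangentSpace (𝓡 n) y) :
    densityForm nabla y X =
      traceForm (chartChristoffel nabla (achart 𝔼 y)) ((achart 𝔼 y).1 y) (X : 𝔼) := by
  have h : ∀ a, comp y a (christoffel nabla y X (coordVec y a)) =
      chartChristoffel nabla (achart 𝔼 y) ((achart 𝔼 y).1 y) (X : 𝔼)
        (EuclideanSpace.single a 1) a := fun a =>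
    congrArg (comp y a) (christoffel_eq nabla y X (coordVec y a))
  rw [densityForm, Finset.sum_congr rfl fun a _ => h a, ← traceL_euclidean]
  simp only [traceForm, finrank_euclideanSpace, Fintype.card_fin]
  rw [div_eq_inv_mul]
  rfl

/-- `densityForm` uses a different chart at each point. In one fixed chart this produces the
correction by `dLogDensity`. -/
theorem densityForm_eq_chart (nabla : AffineConnection n M) (i : atlas 𝔼 M) {y : M}
    (hy : y ∈ i.1.source) (X : TangentSpace (𝓡 n) y) :
    densityForm nabla y X = traceForm (chartChristoffel nabla i) (i.1 y) (chartVec i y X) -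
      dLogDensity i (achart 𝔼 y) y (chartVec i y X) := by
  rw [densityForm_eq, ← traceForm_change nabla i _ hy (mem_chart_source 𝔼 y),
    tangentChange_chartVec i hy]

theorem mfderiv_eq_chart (i : atlas 𝔼 M) {y : M} (hy : y ∈ i.1.source) {f : M → G}
    (hf : DifferentiableAt ℝ (fun z => f (i.1.symm z)) (i.1 y)) (X : TangentSpace (𝓡 n) y) :
    (mfderiv (𝓡 n) 𝓘(ℝ, G) f y X : G) =
      fderiv ℝ (fun z => f (i.1.symm z)) (i.1 y) (chartVec i y X) := by
  have h := (hasMFDerivAt_comp_chart i hy hf).congr_of_eventuallyEq (f₁ := f) (by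
    filter_upwards [i.1.open_source.mem_nhds hy] with y' hy'
    simp [i.1.left_inv hy'])
  rw [h.mfderiv]
  rfl

theorem densityFactor_eq_exp (w : ℝ) (i j : atlas 𝔼 M) {y : M}
    (hy : y ∈ i.1.source ∩ j.1.source) :
    densityFactor w i j y = Real.exp (w * Real.log (densityFactor 1 i j y)) := by
  have h := abs_pos.2 (det_tangentChange_ne_zero i j hy)
  rw [densityFactor, densityFactor, Real.log_rpow h, Real.rpow_def_of_pos h]
  congr 1
  ring

/-- The transition function of weight `w` is `g^w`, with `g` that of `E(1)`, and `d(g^w) = w g^w d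
log g`. -/
theorem hasFDerivAt_densityFactor (w : ℝ) (i j : atlas 𝔼 M) {y : M} (hi : y ∈ i.1.source)
    (hj : y ∈ j.1.source) : HasFDerivAt (fun z => densityFactor w i j (i.1.symm z))
      ((w * densityFactor w i j y) • dLogDensity i j y) (i.1 y) := by
  have hl : HasFDerivAt (fun z => Real.log (densityFactor 1 i j (i.1.symm z)))
      (dLogDensity i j y) (i.1 y) :=
    (((contDiffOn_logDensity i j).contDiffAt ((i.1.symm ≫ₕ j.1).open_source.mem_nhds
      (mem_overlap' i j ⟨hi, hj⟩))).differentiableAt (by simp)).hasFDerivAt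
  have h := (hl.const_mul w).exp
  simp only [i.1.left_inv hi, ← densityFactor_eq_exp w i j ⟨hi, hj⟩] at h
  rw [smul_smul, mul_comm] at h
  refine h.congr_of_eventuallyEq ?_
  filter_upwards [(i.1.symm ≫ₕ j.1).open_source.mem_nhds (mem_overlap' i j ⟨hi, hj⟩)] with z hz
  exact densityFactor_eq_exp w i j (mem_overlap i j hz)

omit [IsManifold (𝓡 n) ∞ M] in
/-- Change of chart for the representatives of a section. -/
theorem coordChange_eventuallyEq (Z : VectorBundleCore ℝ M G (atlas 𝔼 M))
    (hb : ∀ i, Z.baseSet i = i.1.source) (i j : atlas 𝔼 M) (s : Π y, Z.Fiber y) {y : M}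
    (hi : y ∈ i.1.source) (hj : y ∈ j.1.source) :
    (fun z => Z.coordChange (Z.indexAt (i.1.symm z)) j (i.1.symm z) (s (i.1.symm z)))
      =ᶠ[nhds (i.1 y)] fun z => Z.coordChange i j (i.1.symm z) (coreCoord Z i s z) := by
  filter_upwards [(i.1.symm ≫ₕ j.1).open_source.mem_nhds (by
    simp only [mfld_simps]
    exact ⟨i.1.map_source hi, by simpa [i.1.left_inv hi] using hj⟩)] with z hz
  simp only [mfld_simps] at hz
  exact (Z.coordChange_comp _ i j _ ⟨⟨Z.mem_baseSet_at _, (hb i).symm ▸ i.1.map_target hz.1⟩,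
    (hb j).symm ▸ hz.2⟩ _).symm

/-- The derivative of the transition function to the preferred chart cancels the `dLogDensity`
correction of `densityForm`. -/
theorem hasConnectionForm_densityDeriv (nabla : AffineConnection n M) (w : ℝ) (i : atlas 𝔼 M) :
    HasConnectionForm (densityCore n M w) (densityDeriv nabla) i fun z =>
      (w • traceForm (chartChristoffel nabla i) z).smulRight (ContinuousLinearMap.id ℝ ℝ) := by
  intro s y hy hs X
  have hj := mem_chart_source 𝔼 y
  set j := achart 𝔼 y
  set σ := coreCoord (densityCore n M w) i s
  have hev := coordChange_eventuallyEq (densityCore n M w) (fun _ => rfl) i j s hy hj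
  have hd := (hasFDerivAt_densityFactor w i j hy hj).mul hs.hasFDerivAt
  have hd' : HasFDerivAt (fun z => densityCoord j s (i.1.symm z)) _ (i.1 y) :=
    hd.congr_of_eventuallyEq hev
  obtain ⟨s₀, hs₀⟩ : ∃ s₀ : ℝ, s₀ = s y := ⟨s y, rfl⟩
  have h1 : (show ℝ from densityDeriv nabla s y X) = (fderiv ℝ (fun z => densityCoord j s (i.1.symm z)) (i.1 y)
      (chartVec i y X) + w * densityForm nabla y X * s₀ : ℝ) := by
    rw [← mfderiv_eq_chart i hy hd'.differentiableAt, hs₀]; rfl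
  have h2 : s₀ = densityFactor w i j y * σ (i.1 y) := by
    have h := coreCoord_chart (densityCore n M w) i s hy
    have h' := (densityCore n M w).coordChange_comp j i j y ⟨⟨hj, hy⟩, hj⟩ (s y)
    exact hs₀.trans <| (h'.trans ((densityCore n M w).coordChange_self j y hj (s y))).symm.trans
      (congrArg ((densityCore n M w).coordChange i j y) h.symm)
  have h3 : densityFactor w j i y * densityFactor w i j y = 1 := by
    rw [densityFactor_comp w i j i ⟨⟨hy, hj⟩, hy⟩, densityFactor_self w i hy]
  have h4 : (densityCore n M w).coordChange ((densityCore n M w).indexAt y) i y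
      (densityDeriv nabla s y X) = densityFactor w j i y * (show ℝ from densityDeriv nabla s y X) :=
    rfl
  rw [h4, h1, h2, hd'.fderiv, densityForm_eq_chart nabla i hy]
  simp only [add_apply, smul_apply, smul_eq_mul, ContinuousLinearMap.smulRight_apply,
    ContinuousLinearMap.id_apply, i.1.left_inv hy]
  linear_combination (fderiv ℝ σ (i.1 y) (chartVec i y X) +
    w * traceForm (chartChristoffel nabla i) (i.1 y) (chartVec i y X) * σ (i.1 y)) * h3

/-- Two cancellations occur: the derivative of `tangentChange` against the inhomogeneous term of the
Christoffel symbols, and the derivative of the density factor against the `dLogDensity` correction.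
-/
theorem hasConnectionForm_weightedTangentDeriv (nabla : AffineConnection n M) (w : ℝ)
    (i : atlas 𝔼 M) :
    HasConnectionForm (weightedTangentCore n M w) (weightedTangentDeriv nabla) i fun z =>
      chartChristoffel nabla i z +
      (w • traceForm (chartChristoffel nabla i) z).smulRight (ContinuousLinearMap.id ℝ 𝔼) := by
  intro s y hy hs X
  have hj := mem_chart_source 𝔼 y
  set j := achart 𝔼 y
  set σ := coreCoord (weightedTangentCore n M w) i s
  have hev := coordChange_eventuallyEq (weightedTangentCore n M w) (fun _ => rfl) i j s hy hj
  have hA := ((contDiffAt_tangentChange i j hy hj).differentiableAt (by simp)).hasFDerivAt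
  have hd := (hasFDerivAt_densityFactor w i j hy hj).smul (hA.clm_apply hs.hasFDerivAt)
  have hd' : HasFDerivAt (fun z => weightedTangentCoord j s (i.1.symm z)) _ (i.1 y) :=
    hd.congr_of_eventuallyEq hev
  obtain ⟨s₀, hs₀⟩ : ∃ s₀ : 𝔼, s₀ = s y := ⟨s y, rfl⟩
  have h1 : (show 𝔼 from weightedTangentDeriv nabla s y X) =
      (fderiv ℝ (fun z => weightedTangentCoord j s (i.1.symm z)) (i.1 y) (chartVec i y X) +
        chartChristoffel nabla j (j.1 y) (X : 𝔼) s₀ +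
        (w * densityForm nabla y X) • s₀ : 𝔼) := by
    rw [← mfderiv_eq_chart i hy hd'.differentiableAt, hs₀]
    exact congrArg (fun t : 𝔼 =>
      (show 𝔼 from mfderiv (𝓡 n) 𝓘(ℝ, 𝔼) (weightedTangentCoord j s) y X) + t +
      (w * densityForm nabla y X) • (show 𝔼 from s y)) (christoffel_eq nabla y X (s y))
  have h2 : s₀ = densityFactor w i j y • tangentChange i j y (σ (i.1 y)) := by
    have h := coreCoord_chart (weightedTangentCore n M w) i s hy
    have h' := (weightedTangentCore n M w).coordChange_comp j i j y ⟨⟨hj, hy⟩, hj⟩ (s y)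
    exact hs₀.trans <| (h'.trans ((weightedTangentCore n M w).coordChange_self j y hj (s y))).symm.trans
      (congrArg ((weightedTangentCore n M w).coordChange i j y) h.symm)
  have h3 : densityFactor w j i y * densityFactor w i j y = 1 := by
    rw [densityFactor_comp w i j i ⟨⟨hy, hj⟩, hy⟩, densityFactor_self w i hy]
  have h4 : (weightedTangentCore n M w).coordChange ((weightedTangentCore n M w).indexAt y) i y
      (weightedTangentDeriv nabla s y X) = densityFactor w j i y • tangentChange j i y
        (show 𝔼 from weightedTangentDeriv nabla s y X) :=
    rfl
  have h5 : (X : 𝔼) = tangentChange i j y (chartVec i y X) := (tangentChange_chartVec i hy X).symm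
  have h6 : (show 𝔼 from weightedTangentDeriv nabla s y X) = (densityFactor w i j y • tangentChange i j y
      (fderiv ℝ σ (i.1 y) (chartVec i y X) +
        chartChristoffel nabla i (i.1 y) (chartVec i y X) (σ (i.1 y)) +
        (w * traceForm (chartChristoffel nabla i) (i.1 y) (chartVec i y X)) • σ (i.1 y)) : 𝔼) := by
    rw [h1, h2, hd'.fderiv, densityForm_eq_chart nabla i hy]
    have h7 := chartChristoffel_change nabla i j hy hj (chartVec i y X) (σ (i.1 y))
    rw [← h5] at h7
    rw [map_smul, h7]
    simp only [add_apply, smul_apply, smul_eq_mul, ContinuousLinearMap.smulRight_apply,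
      ContinuousLinearMap.comp_apply, ContinuousLinearMap.flip_apply, i.1.left_inv hy, map_add,
      map_smul]
    module
  rw [h4, h6]
  simp only [map_smul, smul_smul, h3, one_smul, tangentChange_tangentChange i j i hy hj hy,
    tangentChange_apply_self i hy, add_apply, ContinuousLinearMap.smulRight_apply, smul_apply,
    smul_eq_mul, ContinuousLinearMap.id_apply]
  abel

end Weighted
end ProjectiveTractor
end

noncomputable section

namespace ProjectiveTractor

/-! ### The tractor connection in a chart -/

section TractorForm

variable {n : ℕ} {M : Type*} [TopologicalSpace M]
  [ChartedSpace (EuclideanSpace ℝ (Fin n)) M] [IsManifold (𝓡 n) ∞ M]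

local notation "𝔼" => EuclideanSpace ℝ (Fin n)

/-- The curvature of a smooth affine connection in a chart. -/
theorem chartVec_curvature [T2Space M] {nabla : AffineConnection n M}
    (h : nabla.ContMDiffCovariantDerivative ∞) (i : atlas 𝔼 M) {y : M} (hy : y ∈ i.1.source)
    (u v w : TangentSpace (𝓡 n) y) :
    chartVec i y (curvature 𝔼 nabla.deriv y u v w) =
      flatCurvature (chartChristoffel nabla i) (i.1 y) (chartVec i y u) (chartVec i y v)
        (chartVec i y w) := by
  refine coordChange_curvature (tangentBundleCore (𝓡 n) M) nabla.deriv i _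
    (hasConnectionForm_deriv nabla i) hy
    ((contDiffAt_chartChristoffel h i hy).differentiableAt (by simp)) u v w ?_
  exact ((contDiffAt_tangentChange' i (achart 𝔼 y) hy (mem_chart_source 𝔼 y)).clm_apply
    contDiffAt_const).congr_of_eventuallyEq (vectorCoord_extend i hy w)

/-- The coordinates of tangent vectors as a continuous linear equivalence. -/
def chartEquiv (i : atlas 𝔼 M) {y : M} (hy : y ∈ i.1.source) : 𝔼 ≃L[ℝ] 𝔼 :=
  ContinuousLinearEquiv.equivOfInverse (tangentChange (achart 𝔼 y) i y)
    (tangentChange i (achart 𝔼 y) y) (fun X => tangentChange_chartVec i hy X)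
    (fun v => chartVec_frame i v hy)

theorem ricci_eq_chart [T2Space M] {nabla : AffineConnection n M}
    (h : nabla.ContMDiffCovariantDerivative ∞) (i : atlas 𝔼 M) {y : M} (hy : y ∈ i.1.source)
    (u v : TangentSpace (𝓡 n) y) :
    ricci nabla y u v = ricciForm (flatCurvature (chartChristoffel nabla i) (i.1 y))
      (chartVec i y u) (chartVec i y v) := by
  set R := flatCurvature (chartChristoffel nabla i) (i.1 y)
  set L := (R.flip (chartVec i y u)).flip (chartVec i y v)
  have hR : ∀ X : TangentSpace (𝓡 n) y, curvature 𝔼 nabla.deriv y X u v =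
      (chartEquiv i hy).symm (L (chartEquiv i hy X)) := fun X => by
    rw [← frame_chartVec i hy (curvature 𝔼 nabla.deriv y X u v), chartVec_curvature h i hy]
    rfl
  rw [ricciForm_apply, ← traceL_conj (chartEquiv i hy).symm, traceL_euclidean]
  exact Finset.sum_congr rfl fun a _ => congrArg (comp y a) (hR (coordVec y a))

theorem schouten_eq_chart [T2Space M] {nabla : AffineConnection n M}
    (h : nabla.ContMDiffCovariantDerivative ∞) (i : atlas 𝔼 M) {y : M} (hy : y ∈ i.1.source)
    (u v : TangentSpace (𝓡 n) y) :
    schouten nabla y u v = schoutenForm (flatCurvature (chartChristoffel nabla i) (i.1 y))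
      (chartVec i y u) (chartVec i y v) := by
  rw [schouten, ricci_eq_chart h i hy, ricci_eq_chart h i hy, schoutenForm, finrank_euclideanSpace,
    Fintype.card_fin]

theorem coreCoord_projTangent (i : atlas 𝔼 M) (U : Π y : M, Tractor M n y) (z : 𝔼) :
    coreCoord (weightedTangentCore n M (-1)) i (projTangent U) z =
      (coreCoord (tractorCore n M) i U z).1 := rfl

/-- The `dLogDensity` term of `tractorChange` matches the transformation of `θ`, so the formula `ρ -
θ(ν)` holds in every chart. -/
theorem coreCoord_projDensity (nabla : AffineConnection n M) (i : atlas 𝔼 M)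
    (U : Π y : M, Tractor M n y) {z : 𝔼} (hz : z ∈ i.1.target) :
    coreCoord (densityCore n M (-1)) i (projDensity nabla U) z =
      (coreCoord (tractorCore n M) i U z).2 -
        traceForm (chartChristoffel nabla i) z (coreCoord (tractorCore n M) i U z).1 := by
  set y := i.1.symm z
  have hy := i.1.map_target hz
  have hj := mem_chart_source 𝔼 y
  obtain ⟨u, hu⟩ : ∃ u : 𝔼 × ℝ, u = U y := ⟨U y, rfl⟩
  have h1 : coreCoord (densityCore n M (-1)) i (projDensity nabla U) z =
      densityFactor (-1) (achart 𝔼 y) i y * (u.2 -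
      traceForm (chartChristoffel nabla (achart 𝔼 y)) ((achart 𝔼 y).1 y) u.1) := by
    refine Eq.trans ?_ (congrArg (fun t => densityFactor (-1) (achart 𝔼 y) i y * (u.2 - t))
      (densityForm_eq nabla y u.1))
    rw [hu]; rfl
  have h2 : coreCoord (tractorCore n M) i U z = densityFactor (-1) (achart 𝔼 y) i y •
      (tangentChange (achart 𝔼 y) i y u.1, u.2 - dLogDensity (achart 𝔼 y) i y u.1) := by
    rw [hu]; rfl
  have h3 := traceForm_change nabla (achart 𝔼 y) i hj hy u.1
  rw [i.1.right_inv hz] at h3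
  rw [h1, h2]
  simp only [Prod.smul_fst, Prod.smul_snd, map_smul, h3, smul_eq_mul]
  ring

theorem coordChange_ofSplitting (nabla : AffineConnection n M) (i : atlas 𝔼 M) {y : M}
    (hy : y ∈ i.1.source) (ν : WeightedTangent M n (-1) y) (ρ : Density M n (-1) y) :
    (tractorCore n M).coordChange (achart 𝔼 y) i y (ofSplitting nabla y ν ρ) =
      ((weightedTangentCore n M (-1)).coordChange (achart 𝔼 y) i y ν,
        (densityCore n M (-1)).coordChange (achart 𝔼 y) i y ρ +
          traceForm (chartChristoffel nabla i) (i.1 y)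
            ((weightedTangentCore n M (-1)).coordChange (achart 𝔼 y) i y ν)) := by
  obtain ⟨ν₀, hν⟩ : ∃ v : 𝔼, v = ν := ⟨ν, rfl⟩
  obtain ⟨ρ₀, hρ⟩ : ∃ r : ℝ, r = ρ := ⟨ρ, rfl⟩
  have hj := mem_chart_source 𝔼 y
  have h1 : (tractorCore n M).coordChange (achart 𝔼 y) i y (ofSplitting nabla y ν ρ) =
      densityFactor (-1) (achart 𝔼 y) i y • (tangentChange (achart 𝔼 y) i y ν₀,
        ρ₀ + traceForm (chartChristoffel nabla (achart 𝔼 y)) ((achart 𝔼 y).1 y) ν₀ -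
          dLogDensity (achart 𝔼 y) i y ν₀) := by
    refine Eq.trans ?_ (congrArg (fun t => densityFactor (-1) (achart 𝔼 y) i y •
      (tangentChange (achart 𝔼 y) i y ν₀, ρ₀ + t - dLogDensity (achart 𝔼 y) i y ν₀))
      (densityForm_eq nabla y ν₀))
    rw [hν, hρ]; rfl
  have h2 : (weightedTangentCore n M (-1)).coordChange (achart 𝔼 y) i y ν =
      densityFactor (-1) (achart 𝔼 y) i y • tangentChange (achart 𝔼 y) i y ν₀ := by
    rw [hν]; rfl
  have h3 : (densityCore n M (-1)).coordChange (achart 𝔼 y) i y ρ =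
      densityFactor (-1) (achart 𝔼 y) i y * ρ₀ := by
    rw [hρ]; rfl
  have h4 := traceForm_change nabla (achart 𝔼 y) i hj hy ν₀
  rw [h1, h2, h3, map_smul, h4]
  ext1
  · rfl
  · simp only [Prod.smul_snd, smul_eq_mul]
    ring

/-- The tractor connection in a chart. -/
theorem hasConnectionForm_tractorConnection [T2Space M] (hn : 2 ≤ n)
    {nabla : AffineConnection n M} (h : IsSmoothTorsionFree nabla) (i : atlas 𝔼 M) :
    HasConnectionForm (tractorCore n M) (tractorConnection nabla) i
      (tractorForm (chartChristoffel nabla i)) := by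
  intro U y hy hU X
  set Γ := chartChristoffel nabla i
  have hΓ : ContDiffAt ℝ ∞ Γ (i.1 y) := contDiffAt_chartChristoffel h.smooth i hy
  have hs := eventually_chartChristoffel_symm h.torsion i hy
  set V := coreCoord (tractorCore n M) i U with hV
  have hθ := ((contDiffAt_traceForm hΓ).differentiableAt (by simp)).hasFDerivAt
  have hd1 := hU.hasFDerivAt.fst
  have hd2 := hU.hasFDerivAt.snd.sub (hθ.clm_apply hd1)
  have hν : HasFDerivAt (coreCoord (weightedTangentCore n M (-1)) i (projTangent U)) _ (i.1 y) :=
    hd1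
  have hevρ : coreCoord (densityCore n M (-1)) i (projDensity nabla U) =ᶠ[nhds (i.1 y)]
      fun z => (V z).2 - traceForm Γ z (V z).1 := by
    filter_upwards [i.1.open_target.mem_nhds (i.1.map_source hy)] with z hz
    exact coreCoord_projDensity nabla i U hz
  have hρ := hd2.congr_of_eventuallyEq hevρ
  have e1 := hasConnectionForm_weightedTangentDeriv nabla (-1) i (projTangent U) y hy
    hν.differentiableAt X
  have e2 := hasConnectionForm_densityDeriv nabla (-1) i (projDensity nabla U) y hy
    hρ.differentiableAt X
  rw [hν.fderiv] at e1
  rw [hρ.fderiv, hevρ.self_of_nhds] at e2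
  have hfr : (2 : ℕ) ≤ Module.finrank ℝ 𝔼 := by simpa using hn
  set N := weightedTangentDeriv nabla (projTangent U) y X
  set R := densityDeriv nabla (projDensity nabla U) y X
  set g := densityFactor (-1) (achart 𝔼 y) i y
  obtain ⟨ν₀, hν₀⟩ : ∃ v : 𝔼, v = projTangent U y := ⟨projTangent U y, rfl⟩
  obtain ⟨ρ₀, hρ₀⟩ : ∃ r : ℝ, r = projDensity nabla U y := ⟨projDensity nabla U y, rfl⟩
  have c1 : (V (i.1 y)).1 = g • tangentChange (achart 𝔼 y) i y ν₀ := by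
    rw [hV, coreCoord_chart (tractorCore n M) i U hy, hν₀]; rfl
  have c2 : (V (i.1 y)).2 - traceForm Γ (i.1 y) (V (i.1 y)).1 = g * ρ₀ := by
    refine hevρ.self_of_nhds.symm.trans ?_
    rw [coreCoord_chart (densityCore n M (-1)) i _ hy, hρ₀]; rfl
  have hN : (weightedTangentCore n M (-1)).coordChange (achart 𝔼 y) i y
      (N + (show WeightedTangent M n (-1) y from ρ₀ • (show 𝔼 from X))) =
      (weightedTangentCore n M (-1)).coordChange (achart 𝔼 y) i y N +
        (g * ρ₀) • chartVec i y X := by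
    refine (map_add _ _ _).trans (congrArg (fun t : 𝔼 =>
      (weightedTangentCore n M (-1)).coordChange (achart 𝔼 y) i y N + t) ?_)
    change g • tangentChange (achart 𝔼 y) i y (ρ₀ • (show 𝔼 from X)) = _
    rw [map_smul, smul_smul]
    rfl
  have hR : (densityCore n M (-1)).coordChange (achart 𝔼 y) i y
      (R - (show Density M n (-1) y from schouten nabla y X (show 𝔼 from ν₀))) =
      (densityCore n M (-1)).coordChange (achart 𝔼 y) i y R -
        (rhoForm Γ (i.1 y) (chartVec i y X) (V (i.1 y)).1 -
          thetaForm Γ (i.1 y) (chartVec i y X) (V (i.1 y)).1) := by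
    refine (map_sub _ _ _).trans (congrArg (fun t : ℝ =>
      (densityCore n M (-1)).coordChange (achart 𝔼 y) i y R - t) ?_)
    change g * schouten nabla y X (show 𝔼 from ν₀) = _
    rw [c1, map_smul, map_smul, smul_eq_mul, smul_eq_mul, ← mul_sub,
      ← schoutenForm_eq hfr hΓ hs]
    exact congrArg (g * ·) (schouten_eq_chart h.smooth i hy X ν₀)
  have hT : (tractorCore n M).coordChange ((tractorCore n M).indexAt y) i y
      (tractorConnection nabla U y X) = (tractorCore n M).coordChange (achart 𝔼 y) i y
      (ofSplitting nabla y (N + (show WeightedTangent M n (-1) y from ρ₀ • (show 𝔼 from X)))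
        (R - (show Density M n (-1) y from schouten nabla y X (show 𝔼 from ν₀)))) := by
    rw [hν₀, hρ₀]; rfl
  rw [hT, coordChange_ofSplitting nabla i hy, hN, hR, ← c2]
  have e1' : (weightedTangentCore n M (-1)).coordChange (achart 𝔼 y) i y N = _ := e1
  have e2' : (densityCore n M (-1)).coordChange (achart 𝔼 y) i y R = _ := e2
  rw [e1', e2', tractorForm_apply, coreCoord_projTangent]
  -- In the first component the weight `-1` removes `θ(X) ν`, and `ρ - θ(ν)` in place of `ρ` removes
  -- `θ(ν) X`, which turns `Γ` into its Thomas symbols. In the second, `-P = K - Q`, and `K` cancels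
  -- all terms with `θ` that come from the splitting, leaving `-Q`.
  ext1
  · simp only [add_apply, ContinuousLinearMap.smulRight_apply, smul_apply, smul_eq_mul,
      ContinuousLinearMap.id_apply, ContinuousLinearMap.comp_apply, Prod.fst_add,
      ContinuousLinearMap.coe_fst', thomas_apply]
    module
  · simp only [add_apply, sub_apply, ContinuousLinearMap.smulRight_apply, smul_apply, smul_eq_mul,
      ContinuousLinearMap.id_apply, ContinuousLinearMap.comp_apply, Prod.snd_add, map_add,
      map_smul, map_sub, ContinuousLinearMap.flip_apply,
      ContinuousLinearMap.coe_fst', ContinuousLinearMap.coe_snd', thomas_apply, thetaForm_apply]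
    ring

end TractorForm
end ProjectiveTractor
end

noncomputable section

namespace ProjectiveTractor

/-! ### Endomorphisms of `E × ℝ` that kill `(0, 1)` -/

section Block

variable {E : Type*} [AddCommGroup E] [Module ℝ E]

/-- The upper left block of an endomorphism of `E × ℝ`. -/
def block (T : Module.End ℝ (E × ℝ)) : Module.End ℝ E :=
  LinearMap.fst ℝ E ℝ ∘ₗ T ∘ₗ LinearMap.inl ℝ E ℝ

/-- What `S` sends into the line of `(0, 1)` is killed by `T`, so nothing is lost by projecting in
between. -/
theorem block_mul {T S : Module.End ℝ (E × ℝ)} (hT : T (0, 1) = 0) :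
    block (T * S) = block T * block S := by
  ext w
  have h : S (w, 0) = ((S (w, 0)).1, 0) + (S (w, 0)).2 • ((0, 1) : E × ℝ) := by ext <;> simp
  change (T (S (w, 0))).1 = (T ((S (w, 0)).1, 0)).1
  rw [h, map_add, map_smul, hT]
  simp

theorem block_list_prod (l : List (Module.End ℝ (E × ℝ))) (hl : ∀ T ∈ l, T (0, 1) = 0) :
    block l.prod = (l.map block).prod := by
  induction l with
  | nil => ext w; simp [block]
  | cons T l ih =>
    rw [List.prod_cons, block_mul (hl T List.mem_cons_self),
      ih fun S hS => hl S (List.mem_cons_of_mem T hS), List.map_cons, List.prod_cons]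

/-- The empty product is the identity and does not kill `(0, 1)`; this is one place where `1 ≤ k`
matters. -/
theorem list_prod_apply_eq_zero (l : List (Module.End ℝ (E × ℝ))) (hl : ∀ T ∈ l, T (0, 1) = 0)
    (h0 : l ≠ []) : l.prod (0, 1) = 0 := by
  induction l with
  | nil => exact absurd rfl h0
  | cons T l ih =>
    rcases eq_or_ne l [] with rfl | h
    · simpa using hl T List.mem_cons_self
    · rw [List.prod_cons, Module.End.mul_apply, ih (fun S hS => hl S (List.mem_cons_of_mem T hS)) h,
        map_zero]

variable [FiniteDimensional ℝ E]

/-- `T` factors through the projection to `E`, and the two compositions of a pair of maps have equal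
traces. -/
theorem trace_block {T : Module.End ℝ (E × ℝ)} (hT : T (0, 1) = 0) :
    LinearMap.trace ℝ E (block T) = LinearMap.trace ℝ (E × ℝ) T := by
  have h : (T ∘ₗ LinearMap.inl ℝ E ℝ) ∘ₗ LinearMap.fst ℝ E ℝ = T := by
    refine LinearMap.prod_ext (by ext <;> rfl) ?_
    have h0 : T (0, 0) = 0 := map_zero T
    ext <;> simp [hT, h0]
  rw [block, ← LinearMap.trace_comp_comm', h]

theorem trace_list_prod_block (l : List (Module.End ℝ (E × ℝ))) (hl : ∀ T ∈ l, T (0, 1) = 0)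
    (h0 : l ≠ []) :
    LinearMap.trace ℝ (E × ℝ) l.prod = LinearMap.trace ℝ E (l.map block).prod := by
  rw [← block_list_prod l hl, trace_block (list_prod_apply_eq_zero l hl h0)]

end Block

/-! ### Both families of forms in terms of the Thomas curvature -/

section Main

variable {n : ℕ} {M : Type*} [TopologicalSpace M]
  [ChartedSpace (EuclideanSpace ℝ (Fin n)) M] [IsManifold (𝓡 n) ∞ M]

local notation "𝔼" => EuclideanSpace ℝ (Fin n)

section CurvatureForm

variable {F : Type*} [NormedAddCommGroup F] [NormedSpace ℝ F]
  {V : M → Type*} [TopologicalSpace (Bundle.TotalSpace F V)]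
  [∀ x, AddCommGroup (V x)] [∀ x, Module ℝ (V x)] [∀ x, TopologicalSpace (V x)]
  [FiberBundle F V] [VectorBundle ℝ F V] [FiniteDimensional ℝ F]

/-- Traces are invariant under conjugation, so any linear identification of the fibre with the model
may be used. -/
theorem curvatureForm_eq (D : (Π y, V y) → Π y : M, TangentSpace (𝓡 n) y → V y) (x : M)
    (e : V x ≃ₗ[ℝ] F) (R : 𝔼 → 𝔼 → Module.End ℝ F)
    (h : ∀ (u v : TangentSpace (𝓡 n) x) (w : V x), e (curvature F D x u v w) = R u v (e w))
    (k : ℕ) (v : Fin (2 * k) → 𝔼) :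
    curvatureForm F D k x v = ((2 * k).factorial : ℝ)⁻¹ * ∑ τ : Equiv.Perm (Fin (2 * k)),
      ((Equiv.Perm.sign τ : ℤ) : ℝ) * LinearMap.trace ℝ F (List.ofFn fun i : Fin k =>
        R (v (τ ⟨2 * i, by omega⟩)) (v (τ ⟨2 * i + 1, by omega⟩))).prod := by
  have h1 : ∀ u v : TangentSpace (𝓡 n) x, e.conjRingEquiv (curvatureEnd F D x u v) = R u v := by
    intro u v
    refine LinearMap.ext fun w => ?_
    have h2 : curvatureEnd F D x u v = (e.symm : F →ₗ[ℝ] V x) ∘ₗ R u v ∘ₗ (e : V x →ₗ[ℝ] F) := by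
      refine (fibreBasis F x).ext fun a => ?_
      rw [curvatureEnd, Module.Basis.constr_basis]
      exact (e.symm_apply_eq.2 (h u v _).symm).symm
    rw [h2]
    simp
  unfold curvatureForm
  congr 1
  refine Finset.sum_congr rfl fun τ _ => ?_
  rw [← LinearMap.trace_conj' _ e]
  congr 2
  refine (map_list_prod e.conjRingEquiv _).trans ?_
  rw [List.map_ofFn]
  congr 2
  funext i
  exact h1 _ _

end CurvatureForm

variable {G : Type*} [NormedAddCommGroup G] [NormedSpace ℝ G]

/-- In the preferred chart at `x` the extension of `w` is constant and vectors at `x` are their own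
coordinates, so no transition maps remain. -/
theorem curvature_preferred_chart (Z : VectorBundleCore ℝ M G (atlas 𝔼 M))
    (hb : ∀ i, Z.baseSet i = i.1.source) (hi : ∀ x, Z.indexAt x = achart 𝔼 x)
    (D : (Π y, Z.Fiber y) → Π y : M, TangentSpace (𝓡 n) y → Z.Fiber y) (x : M)
    (A : 𝔼 → 𝔼 →L[ℝ] G →L[ℝ] G) (hD : HasConnectionForm Z D (achart 𝔼 x) A)
    (hA : DifferentiableAt ℝ A ((achart 𝔼 x).1 x)) (u v : TangentSpace (𝓡 n) x) (w : Z.Fiber x) :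
    curvature G D x u v w =
      flatCurvature A ((achart 𝔼 x).1 x) (u : 𝔼) (v : 𝔼) (w : G) := by
  have hx : x ∈ (achart 𝔼 x).1.source := mem_chart_source 𝔼 x
  have hself : ∀ w : Z.Fiber x, Z.coordChange (Z.indexAt x) (achart 𝔼 x) x w = w := fun w => by
    rw [← hi x]
    exact Z.coordChange_self _ x (Z.mem_baseSet_at x) w
  obtain ⟨w', hw'⟩ : ∃ w' : G, w' = w := ⟨w, rfl⟩
  have hw : ContDiffAt ℝ ∞ (coreCoord Z (achart 𝔼 x) (FiberBundle.extend G w))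
      ((achart 𝔼 x).1 x) := by
    refine (contDiffAt_const (c := w')).congr_of_eventuallyEq ?_
    filter_upwards [(achart 𝔼 x).1.open_target.mem_nhds ((achart 𝔼 x).1.map_source hx)] with z hz
    have hz' : (achart 𝔼 x).1.symm z ∈ Z.baseSet (achart 𝔼 x) := by
      rw [hb]; exact (achart 𝔼 x).1.map_target hz
    rw [coreCoord, extend_core Z (by rwa [hi]), hw']
    exact (Z.coordChange_comp _ _ _ _ ⟨⟨by rwa [hi], Z.mem_baseSet_at _⟩, hz'⟩ _).trans
      ((congrArg (fun i => Z.coordChange i (achart 𝔼 x) _ w) (hi x)).trans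
        (Z.coordChange_self _ _ hz' w))
  have h := coordChange_curvature Z D (achart 𝔼 x) A hD hx hA u v w hw
  rw [chartVec_achart, chartVec_achart] at h
  exact (hself _).symm.trans (h.trans (congrArg _ (hself w)))

/-- The tractor connection is the same for all members of the projective structure. -/
theorem tractorConnection_eq [T2Space M] (hn : 2 ≤ n) (P : ProjectiveStructure n M)
    {nabla nabla' : AffineConnection n M} (h : nabla ∈ P.carrier) (h' : nabla' ∈ P.carrier)
    (U : Π y : M, Tractor M n y) (x : M)
    (hU : MDifferentiableAt (𝓡 n) ((𝓡 n).prod 𝓘(ℝ, 𝔼 × ℝ))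
      (fun y => (⟨y, U y⟩ : Bundle.TotalSpace (𝔼 × ℝ) (tractorCore n M).Fiber)) x)
    (X : TangentSpace (𝓡 n) x) :
    tractorConnection nabla U x X = tractorConnection nabla' U x X := by
  have hx : x ∈ (achart 𝔼 x).1.source := mem_chart_source 𝔼 x
  have hd := (mdifferentiableAt_section_iff_core (tractorCore n M) U rfl).1 hU
  have h1 := hasConnectionForm_tractorConnection hn (P.isSmoothTorsionFree nabla h) (achart 𝔼 x)
    U x hx hd X
  have h2 := hasConnectionForm_tractorConnection hn (P.isSmoothTorsionFree nabla' h') (achart 𝔼 x)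
    U x hx hd X
  rw [tractorForm_congr (thomas_chartChristoffel_eq ((P.mem_iff nabla h nabla').1 h').2 _ hx),
    ← h2] at h1
  exact ((tractorCore n M).coordChange_self _ x hx _).symm.trans
    (h1.trans ((tractorCore n M).coordChange_self _ x hx _))

/-- The curvature of the Thomas symbols at `x` in the preferred chart. -/
def thomasCurvature (nabla : AffineConnection n M) (x : M) (u v : 𝔼) : Module.End ℝ 𝔼 :=
  (flatCurvature (thomas (chartChristoffel nabla (achart 𝔼 x))) ((achart 𝔼 x).1 x) u v :
    𝔼 →L[ℝ] 𝔼)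

theorem isBianchi_thomasCurvature [T2Space M] {nabla : AffineConnection n M}
    (h : IsSmoothTorsionFree nabla) (x : M) : IsBianchi (thomasCurvature nabla x) := by
  have hx : x ∈ (achart 𝔼 x).1.source := mem_chart_source 𝔼 x
  refine fun a b c => flatCurvature_bianchi
    ((contDiffAt_thomas (contDiffAt_chartChristoffel h.smooth _ hx)).differentiableAt (by simp))
    ?_ a b c
  filter_upwards [eventually_chartChristoffel_symm h.torsion _ hx] with z hz X v
  exact thomas_symm hz X v

/-- The block of the tractor curvature is the Thomas curvature plus `wedgeId` of the symmetric form
`rhoForm`. This holds for every Weyl connection, scale or not. -/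
theorem q_eq [T2Space M] (hn : 2 ≤ n) {nabla : AffineConnection n M}
    (h : IsSmoothTorsionFree nabla) {k : ℕ} (hk : 1 ≤ k) (x : M)
    (v : Fin (2 * k) → 𝔼) :
    q nabla k x v = ((2 * k).factorial : ℝ)⁻¹ *
      skewTrace (fun _ : Fin k => thomasCurvature nabla x) v := by
  have hx : x ∈ (achart 𝔼 x).1.source := mem_chart_source 𝔼 x
  set Γ := chartChristoffel nabla (achart 𝔼 x)
  set z := (achart 𝔼 x).1 x
  have hΓ : ContDiffAt ℝ ∞ Γ z := contDiffAt_chartChristoffel h.smooth _ hx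
  have hs := eventually_chartChristoffel_symm h.torsion _ hx
  let R : 𝔼 → 𝔼 → Module.End ℝ (𝔼 × ℝ) := fun u v =>
    (flatCurvature (tractorForm Γ) z u v : (𝔼 × ℝ) →L[ℝ] (𝔼 × ℝ))
  have h1 := curvatureForm_eq (V := (tractorCore n M).Fiber) (tractorConnection nabla) x
    (LinearEquiv.refl ℝ (𝔼 × ℝ)) R (fun u v w => curvature_preferred_chart (tractorCore n M)
      (fun _ => rfl) (fun _ => rfl) (tractorConnection nabla) x (tractorForm Γ)
      (hasConnectionForm_tractorConnection hn h _)
      ((contDiffAt_tractorForm hΓ).differentiableAt (by simp)) u v w) k v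
  refine h1.trans ?_
  rw [← skewTrace_add_wedgeId hk (isBianchi_thomasCurvature h x)
    (K := (rhoForm Γ z).toLinearMap₁₂) (rhoForm_symm hΓ hs)]
  have hR : ∀ u v, R u v (0, 1) = 0 := fun u v => (flatCurvature_tractorForm hΓ hs u v 0).2
  have hB : ∀ u v, block (R u v) =
      thomasCurvature nabla x u v + wedgeId (rhoForm Γ z).toLinearMap₁₂ u v := fun u v => by
    ext1 w
    rw [LinearMap.add_apply, wedgeId_apply, ← add_sub_assoc]
    exact (flatCurvature_tractorForm hΓ hs u v (w, 0)).1
  unfold skewTrace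
  congr 1
  refine Finset.sum_congr rfl fun τ _ => ?_
  rw [trace_list_prod_block _ _ (fun h0 => by rw [List.ofFn_eq_nil_iff] at h0; omega),
    List.map_ofFn]
  · congr 4
    funext i
    exact hB _ _
  · intro T hT
    obtain ⟨i, rfl⟩ := List.mem_ofFn.1 hT
    exact hR _ _

theorem p_eq [T2Space M] (hn : 2 ≤ n) {nabla : AffineConnection n M}
    (h : IsSmoothTorsionFree nabla) (hP : IsScaleConnection nabla) {k : ℕ} (hk : 1 ≤ k) (x : M)
    (v : Fin (2 * k) → 𝔼) :
    p nabla k x v = ((2 * k).factorial : ℝ)⁻¹ *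
      skewTrace (fun _ : Fin k => thomasCurvature nabla x) v := by
  have hx : x ∈ (achart 𝔼 x).1.source := mem_chart_source 𝔼 x
  set Γ := chartChristoffel nabla (achart 𝔼 x)
  set z := (achart 𝔼 x).1 x
  have hΓ : ContDiffAt ℝ ∞ Γ z := contDiffAt_chartChristoffel h.smooth _ hx
  have hs := eventually_chartChristoffel_symm h.torsion _ hx
  have hfr : 2 ≤ Module.finrank ℝ 𝔼 := by simpa using hn
  -- Since `P = Q - K` with `Q` symmetric, the scale condition amounts to symmetry of `K`; this also
  -- removes the multiple of the identity from the curvature.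
  have hK : ∀ a b, thetaForm Γ z a b = thetaForm Γ z b a := fun a b => by
    have h2 : ∀ a b : TangentSpace (𝓡 n) x, schouten nabla x a b =
        schoutenForm (flatCurvature Γ z) a b := fun a b => by
      rw [schouten_eq_chart h.smooth (achart 𝔼 x) hx, chartVec_achart, chartVec_achart]
    have h1 := (h2 a b).symm.trans ((hP x a b).trans (h2 b a))
    rw [schoutenForm_eq hfr hΓ hs, schoutenForm_eq hfr hΓ hs, rhoForm_symm hΓ hs] at h1
    exact sub_right_injective h1
  have hR : ∀ u v w : 𝔼, flatCurvature Γ z u v w =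
      (thomasCurvature nabla x u v + wedgeId (thetaForm Γ z).toLinearMap₁₂ u v) w :=
    fun u v w => by
      rw [flatCurvature_eq_thomas hΓ hs, hK u v, sub_self, zero_smul, add_zero,
        LinearMap.add_apply, wedgeId_apply, ← add_sub_assoc]
      rfl
  have h1 := curvatureForm_eq (V := (TangentSpace (𝓡 n) : M → Type _)) nabla.deriv x
    (LinearEquiv.refl ℝ 𝔼)
    (fun c d => thomasCurvature nabla x c d + wedgeId (thetaForm Γ z).toLinearMap₁₂ c d)
    (fun u v w => by
      have h2 := chartVec_curvature h.smooth (achart 𝔼 x) hx u v w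
      rw [chartVec_achart, chartVec_achart, chartVec_achart, chartVec_achart] at h2
      exact h2.trans (hR u v w)) k v
  rw [← skewTrace_add_wedgeId hk (isBianchi_thomasCurvature h x)
    (K := (thetaForm Γ z).toLinearMap₁₂) hK]
  exact h1

end Main
end ProjectiveTractor
end

theorem proposition4p3 {n : ℕ} (hn : 2 ≤ n) {M : Type*} [TopologicalSpace M] [T2Space M]
    [ChartedSpace (EuclideanSpace ℝ (Fin n)) M] [IsManifold (𝓡 n) ∞ M]
    (P : ProjectiveTractor.ProjectiveStructure n M) :
    (∀ nabla ∈ P.carrier, ∀ nabla' ∈ P.carrier,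
      ∀ (U : Π y : M, ProjectiveTractor.Tractor M n y) (x : M),
        MDifferentiableAt (𝓡 n) ((𝓡 n).prod 𝓘(ℝ, EuclideanSpace ℝ (Fin n) × ℝ))
          (fun y => (⟨y, U y⟩ : Bundle.TotalSpace (EuclideanSpace ℝ (Fin n) × ℝ)
            (ProjectiveTractor.tractorCore n M).Fiber)) x →
        ∀ X : TangentSpace (𝓡 n) x,
          ProjectiveTractor.tractorConnection nabla U x X =
            ProjectiveTractor.tractorConnection nabla' U x X) ∧
    ∀ nabla ∈ P.carrier, ∀ nabla' ∈ P.carrier, ProjectiveTractor.IsScaleConnection nabla' →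
      ∀ k : ℕ, 1 ≤ k → ∀ (x : M) (v : Fin (2 * k) → TangentSpace (𝓡 n) x),
        ProjectiveTractor.q nabla k x v = ProjectiveTractor.p nabla' k x v := by
  refine ⟨fun nabla h nabla' h' U x hU X =>
    ProjectiveTractor.tractorConnection_eq hn P h h' U x hU X,
    fun nabla h nabla' h' hP k hk x v => ?_⟩
  -- The two sides are computed from possibly different members of the class, and the Thomas
  -- curvature at `x` is what they share.
  have hT : ProjectiveTractor.thomasCurvature nabla x =
      ProjectiveTractor.thomasCurvature nabla' x := by
    funext u v
    rw [ProjectiveTractor.thomasCurvature, ProjectiveTractor.thomasCurvature,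
      ProjectiveTractor.flatCurvature_congr (ProjectiveTractor.thomas_chartChristoffel_eq
        ((P.mem_iff nabla h nabla').1 h').2 _ (mem_chart_source _ x))]
  refine (ProjectiveTractor.q_eq hn (P.isSmoothTorsionFree nabla h) hk x v).trans ?_
  rw [hT]
  exact (ProjectiveTractor.p_eq hn (P.isSmoothTorsionFree nabla' h') hP hk x v).symm
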